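/- **Setting.** Let $n\ge 1$ and let $\chi\in C_0^\infty(\mathbb R)$ be even with $0\le\chi\le1$, $\chi(r)=1$ for $|r|\le\frac{11}{10}$ and $\chi(r)=0$ for $|r|\ge\frac{19}{10}$. Put $S_k=\chi(2^{-k}|D_x|)$ (the Fourier multiplier with symbol $\chi(2^{-k}|\xi|)$, $D_x=-i\nabla_x$) for $k\ge0$, $S_k=0$ for $k<0$, and $\Delta_k=S_k-S_{k-1}$ for $k\ge0$. For $a\in L^\infty(\mathbb R^n)$ and $m\in\mathbb N_0$ let $T_a^m$ be the modified Bony paraproduct $$T_a^m u=S_{m-1}a\,S_{m+2}u+\sum_{k\ge m+3}S_{k-3}a\,\Delta_k u ,$$ and for $T>0$ let $\mathcal H=C^0([0,T],L^2(\mathbb R^n))\cap C^0([0,T),H^1(\mathbb R^n))\cap C^1([0,T),L^2(\mathbb R^n))$. All functions may be complex valued. **Proposition.** Let $s\in(0,1)$. There is a constant $C_s>0$, depending only on $s$ (and on $n$ and $\chi$), such that the following holds. Let $m\in\mathbb N_0$, let $a$ be a bounded Lipschitz function on $\mathbb R^n$ and $A\ge0$ with $|a(x)|\le A$ and $|a(x)-a(y)|\le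 A|x-y|$ for all $x,y\in\mathbb R^n$, let $\alpha>0$, $\sigma=\frac{1-s}{\alpha}$, $t\in[0,\frac78\sigma]$ with $t<T$, let $w\in\mathcal H$, $1\le i,j\le n$, and set $v_\nu(t,\cdot)=2^{-(s+\alpha t)\nu}\Delta_\nu w(t,\cdot)$. Then $\partial_t v_\nu(t,\cdot)\in L^2$ and $\partial_{x_i}\partial_tv_\nu(t,\cdot)\in L^2$ exist for all $\nu\geq 0$, the series that defines $T_a^m\partial_{x_j}w(t,\cdot)$ converges unconditionally in $L^2$, the three series below converge absolutely, and for every $N>0$ $$\Big|\sum_{\nu\ge0}2^{-(s+\alpha t)\nu}\big\langle\partial_{x_i}\partial_tv_\nu(t,\cdot)\,\big|\,\Delta_\nu\big((a-T_a^m)\partial_{x_j}w(t,\cdot)\big)\big\rangle_{L^2}\Big|\le\frac1N\sum_{\nu\ge0}\|\partial_tv_\nu(t,\cdot)\|_{L^2}^2+C_sA^2N\sum_{\nu\ge0}2^{2\nu}\|v_\nu(t,\cdot)\|_{L^2}^2 .$$ -/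

import Mathlib

open MeasureTheory FourierTransform LineDeriv
open scoped SchwartzMap NNReal ENNReal ContDiff

namespace LittlewoodPaley

/-- The space `ℝⁿ` with its Euclidean norm. -/
abbrev Space (n : ℕ) : Type := EuclideanSpace ℝ (Fin n)

/-- The complex Hilbert space `L²(ℝⁿ)`. -/
abbrev L2 (n : ℕ) : Type := Lp (α := Space n) ℂ 2 (volume : Measure (Space n))

/-- The cutoff profiles from which the Littlewood-Paley decomposition is built: `χ` is smooth and
even, `0 ≤ χ ≤ 1`, `χ = 1` on `|r| ≤ 11/10` and `χ = 0` on `|r| ≥ 19/10`. -/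
structure IsCutoff (χ : ℝ → ℝ) : Prop where
  smooth : ContDiff ℝ ∞ χ
  even : ∀ r, χ (-r) = χ r
  nonneg : ∀ r, 0 ≤ χ r
  le_one : ∀ r, χ r ≤ 1
  eq_one : ∀ r, |r| ≤ 11 / 10 → χ r = 1
  eq_zero : ∀ r, 19 / 10 ≤ |r| → χ r = 0

noncomputable section

variable {n : ℕ}

/-- The symbol of `χ_k(D)`. The frequency variable of `χ_k(D) = χ(2^{-k}|D|)`, `D = -i∇`, is the
angular one; Mathlib's Fourier transform has the kernel `exp(-2πi⟨x, ξ⟩)`, so that `D` corresponds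
to the multiplication by `2πξ`. -/
def symbol (χ : ℝ → ℝ) (k : ℤ) (ξ : Space n) : ℂ :=
  ((χ ((2 : ℝ) ^ (-k) * ‖(2 * Real.pi) • ξ‖) : ℝ) : ℂ)

/-- Pointwise product of a function `b` with `f ∈ L²`, as an element of `L²` (this is the product
whenever it is square integrable, in particular for every bounded measurable `b`). -/
def mulL2 (b : Space n → ℂ) (f : L2 n) : L2 n :=
  open Classical in
  if h : MemLp (fun x => b x * f x) 2 (volume : Measure (Space n)) then h.toLp _ else 0

/-- `S_k f = 𝓕⁻¹(χ_k 𝓕 f)` for `f ∈ L²` and `k ≥ 0`, and `S_k f = 0` for `k < 0`. -/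
def lowFreq (χ : ℝ → ℝ) (k : ℤ) (f : L2 n) : L2 n :=
  if k < 0 then 0 else 𝓕⁻ (mulL2 (symbol χ k) (𝓕 f))

/-- `Δ_0 f = S_0 f` and `Δ_k f = S_k f - S_{k-1} f` for `k ≥ 1`. -/
def block (χ : ℝ → ℝ) (k : ℕ) (f : L2 n) : L2 n :=
  lowFreq χ k f - lowFreq χ ((k : ℤ) - 1) f

/-- `S_k a` for a bounded function `a`: for `k ≥ 0` the Fourier multiplier `χ_k(D)` is the
convolution with the Schwartz function `𝓕⁻¹(χ_k)`, and `S_k a = 0` for `k < 0`. -/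
def lowFreqFun (χ : ℝ → ℝ) (k : ℤ) (a : Space n → ℂ) (x : Space n) : ℂ :=
  if k < 0 then 0
  else ∫ y, (𝓕⁻ (symbol χ k : Space n → ℂ) : Space n → ℂ) y * a (x - y)

/-- The terms `S_{k-3}a Δ_k u`, `k = m + 3 + l`, `l ≥ 0`, of the modified paraproduct. -/
def paraTerm (χ : ℝ → ℝ) (m : ℕ) (a : Space n → ℂ) (u : L2 n) (l : ℕ) : L2 n :=
  mulL2 (lowFreqFun χ ((m : ℤ) + l) a) (block χ (m + 3 + l) u)

/-- Bony's modified paraproduct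
`T_a^m u = S_{m-1}a S_{m+2}u + ∑_{k ≥ m+3} S_{k-3}a Δ_k u` (series in `L²`). -/
def paraproduct (χ : ℝ → ℝ) (m : ℕ) (a : Space n → ℂ) (u : L2 n) : L2 n :=
  mulL2 (lowFreqFun χ ((m : ℤ) - 1) a) (lowFreq χ ((m : ℤ) + 2) u)
    + ∑' l : ℕ, paraTerm χ m a u l

/-- `g ∈ L²` is the distributional derivative `∂f/∂x_j` of `f ∈ L²`. -/
def HasPartial (j : Fin n) (f g : L2 n) : Prop :=
  ∂_{(EuclideanSpace.single j (1 : ℝ) : Space n)} (f : 𝓢'(Space n, ℂ)) = (g : 𝓢'(Space n, ℂ))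

/-- The distributional derivative `∂f/∂x_j`, when it belongs to `L²`. -/
def partialL2 (j : Fin n) (f : L2 n) : L2 n :=
  open Classical in
  if h : ∃ g, HasPartial j f g then h.choose else 0

theorem HasPartial.partialL2_eq {j : Fin n} {f g : L2 n} (h : HasPartial j f g) :
    partialL2 j f = g := by
  have hex : ∃ g, HasPartial j f g := ⟨g, h⟩
  have hc : HasPartial j f (partialL2 j f) := by
    unfold partialL2
    rw [dif_pos hex]
    exact hex.choose_spec
  have heq : Lp.toTemperedDistributionCLM ℂ (volume : Measure (Space n)) 2 (partialL2 j f)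
      = Lp.toTemperedDistributionCLM ℂ (volume : Measure (Space n)) 2 g := by
    simp only [Lp.toTemperedDistributionCLM_apply]
    exact hc.symm.trans h
  exact LinearMap.ker_eq_bot.mp Lp.ker_toTemperedDistributionCLM_eq_bot heq

/-- `w ∈ C⁰([0,T], L²) ∩ C⁰([0,T), H¹) ∩ C¹([0,T), L²)`; the `H¹` norm is the one given by the
`L²` norms of `w` and of its first order distributional derivatives. -/
structure MemH (T : ℝ) (w : ℝ → L2 n) : Prop where
  continuousOn : ContinuousOn w (Set.Icc 0 T)
  hasPartial : ∀ t ∈ Set.Ico 0 T, ∀ j, HasPartial j (w t) (partialL2 j (w t))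
  continuousOn_partial : ∀ j, ContinuousOn (fun t => partialL2 j (w t)) (Set.Ico 0 T)
  contDiffOn : ContDiffOn ℝ 1 w (Set.Ico 0 T)

/-- The weight `2^{-(s+αt)ν}`. -/
def weight (s α t : ℝ) (ν : ℕ) : ℝ := (2 : ℝ) ^ (-((s + α * t) * ν))

/-- `v_ν(t) = 2^{-(s+αt)ν} Δ_ν w(t)`. -/
def vPiece (χ : ℝ → ℝ) (s α : ℝ) (w : ℝ → L2 n) (ν : ℕ) (t : ℝ) : L2 n :=
  weight s α t ν • block χ ν (w t)

/-- `∂_t v_ν(t)`, the derivative of the `L²`-valued function `v_ν` on `[0,T)`. -/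
def dtPiece (χ : ℝ → ℝ) (s α T : ℝ) (w : ℝ → L2 n) (ν : ℕ) (t : ℝ) : L2 n :=
  derivWithin (vPiece χ s α w ν) (Set.Ico 0 T) t

/-- `2^{-(s+αt)ν} ⟨∂_{x_i} ∂_t v_ν(t) | Δ_ν((a - T_a^m) ∂_{x_j} w(t))⟩_{L²}`, with
`⟨f | g⟩_{L²} = ∫ f ḡ dx` (Mathlib's inner product is linear in the second argument). -/
def pairing (χ : ℝ → ℝ) (m : ℕ) (a : Space n → ℂ) (s α T : ℝ) (w : ℝ → L2 n)
    (i j : Fin n) (t : ℝ) (ν : ℕ) : ℂ :=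
  (weight s α t ν : ℂ) *
    inner ℂ
      (block χ ν (mulL2 a (partialL2 j (w t)) - paraproduct χ m a (partialL2 j (w t))))
      (partialL2 i (dtPiece χ s α T w ν t))

end

end LittlewoodPaley

open LittlewoodPaley

/-! The operator `a - T_a^m` gains one derivative on Sobolev spaces of order `-τ`, `0 < τ < 1`, and
`τ = s + αt` stays in a compact part of `(0, 1)` because `t ≤ 7σ/8`.

Since `u = ∑ Δ_k u`, one has `(a - T_a^m)u = ∑ b_k Δ_k u` with `b_k = a - S_{k-3}a` for `k ≥ m+3`
and `b_k = a - S_{m-1}a` for smaller `k` (`IsCutoff.hasSum_remainder`). As `a` is Lipschitz, each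
`b_k` has Lipschitz constant `O(A)` and size `O(A 2^{-k})` (`exists_remCoeff_bounds`). This gives
`‖Δ_ν(b_k Δ_k u)‖ ≲ A 2^{-max(ν,k)} ‖Δ_k u‖` (`IsCutoff.norm_block_mulL2_block_le`). For `ν ≤ k` the
size of `b_k` suffices. For `ν > k`, `Δ_ν` is controlled by differences with step `2^{-ν}`, and
those of `b_k Δ_k u` are `O(A 2^{-ν}) ‖Δ_k u‖`. The spectral supports of the products play no role.

After weighting by `2^{ν(1-τ)}` and `2^{τk}` this kernel decays geometrically in `|ν - k|`, at rate
`τ` for `ν > k` and `1 - τ` for `ν < k`, so Schur's test yields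
`IsCutoff.exists_remainder_estimate`. It is applied to `u = ∂_j w`. Bernstein's inequality trades
`∂_j` on `Δ_k w` for `2^k` and `∂_i` on the spectrally localised `∂_t v_ν` for `2^ν`, and Young's
inequality splits the pairing. -/

namespace LittlewoodPaley

/-! ### Multiplication and translation on `L²`. -/

section L2Tools

variable {n : ℕ}

/-- All norm bounds below reduce to pointwise domination; with Plancherel the same principle handles
Fourier multipliers. -/
theorem norm_le_sum_of_ae_le {ι : Type*} (s : Finset ι) (f : L2 n) (g : ι → L2 n) (c : ι → ℝ)
    (hc : ∀ i ∈ s, 0 ≤ c i) (h : ∀ᵐ x, ‖f x‖ ≤ ∑ i ∈ s, c i * ‖g i x‖) :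
    ‖f‖ ≤ ∑ i ∈ s, c i * ‖g i‖ := by
  have h1 : eLpNorm f 2 volume ≤ ∑ i ∈ s, ENNReal.ofReal (c i * ‖g i‖) := by
    calc eLpNorm f 2 volume ≤ eLpNorm (∑ i ∈ s, fun x => c i * ‖g i x‖) 2 volume := by
          refine eLpNorm_mono_ae_real ?_
          filter_upwards [h] with x hx
          simpa using hx
      _ ≤ ∑ i ∈ s, eLpNorm (fun x => c i * ‖g i x‖) 2 volume := by
          refine eLpNorm_sum_le (fun i _ => ?_) (by norm_num)
          exact ((Lp.aestronglyMeasurable (g i)).norm).const_mul _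
      _ = _ := by
          refine Finset.sum_congr rfl fun i hi => ?_
          have : (fun x => c i * ‖g i x‖) = c i • fun x => ‖g i x‖ := by ext; simp
          rw [this, eLpNorm_const_smul, eLpNorm_norm, Lp.norm_def,
            ENNReal.ofReal_mul (hc i hi), ENNReal.ofReal_toReal (Lp.eLpNorm_ne_top _),
            Real.enorm_eq_ofReal (hc i hi)]
  rw [Lp.norm_def, ← ENNReal.ofReal_sum_of_nonneg
    (fun i hi => mul_nonneg (hc i hi) (norm_nonneg _))] at *
  exact ENNReal.toReal_le_of_le_ofReal
    (Finset.sum_nonneg fun i hi => mul_nonneg (hc i hi) (norm_nonneg _)) h1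

theorem norm_le_mul_of_ae_le (f g : L2 n) {c : ℝ} (hc : 0 ≤ c)
    (h : ∀ᵐ x, ‖f x‖ ≤ c * ‖g x‖) : ‖f‖ ≤ c * ‖g‖ := by
  simpa using norm_le_sum_of_ae_le {()} f (fun _ => g) (fun _ => c) (by simpa) (by simpa)

/-- Ensures that the default value `0` in `mulL2` is never taken for bounded measurable `b`. -/
theorem memLp_mul {b : Space n → ℂ} (hb : Measurable b) {M : ℝ} (hM : ∀ x, ‖b x‖ ≤ M)
    (f : L2 n) : MemLp (fun x => b x * f x) 2 volume := by
  refine (Lp.memLp f).of_le_mul (c := M) (hb.aestronglyMeasurable.mul (Lp.aestronglyMeasurable f)) ?_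
  filter_upwards with x
  rw [norm_mul]
  exact mul_le_mul_of_nonneg_right (hM x) (norm_nonneg _)

theorem coeFn_mulL2 {b : Space n → ℂ} (hb : Measurable b) {M : ℝ} (hM : ∀ x, ‖b x‖ ≤ M)
    (f : L2 n) : mulL2 b f =ᵐ[volume] fun x => b x * f x := by
  rw [mulL2, dif_pos (memLp_mul hb hM f)]
  exact MemLp.coeFn_toLp _

theorem norm_mulL2_le {b : Space n → ℂ} (hb : Measurable b) {M : ℝ} (hM : ∀ x, ‖b x‖ ≤ M)
    (f : L2 n) : ‖mulL2 b f‖ ≤ M * ‖f‖ := by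
  refine norm_le_mul_of_ae_le _ _ ((norm_nonneg _).trans (hM 0)) ?_
  filter_upwards [coeFn_mulL2 hb hM f] with x hx
  rw [hx, norm_mul]
  exact mul_le_mul_of_nonneg_right (hM x) (norm_nonneg _)

theorem mulL2_add {b : Space n → ℂ} (hb : Measurable b) {M : ℝ} (hM : ∀ x, ‖b x‖ ≤ M)
    (f g : L2 n) : mulL2 b (f + g) = mulL2 b f + mulL2 b g := by
  ext1
  filter_upwards [coeFn_mulL2 hb hM f, coeFn_mulL2 hb hM g, coeFn_mulL2 hb hM (f + g),
    Lp.coeFn_add f g, Lp.coeFn_add (mulL2 b f) (mulL2 b g)] with x h1 h2 h3 h4 h5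
  rw [h3, h5, h4, Pi.add_apply, Pi.add_apply, h1, h2, mul_add]

theorem mulL2_smul {b : Space n → ℂ} (hb : Measurable b) {M : ℝ} (hM : ∀ x, ‖b x‖ ≤ M)
    (c : ℂ) (f : L2 n) : mulL2 b (c • f) = c • mulL2 b f := by
  ext1
  filter_upwards [coeFn_mulL2 hb hM f, coeFn_mulL2 hb hM (c • f),
    Lp.coeFn_smul c f, Lp.coeFn_smul c (mulL2 b f)] with x h1 h3 h4 h5
  rw [h3, h5, h4, Pi.smul_apply, Pi.smul_apply, h1, smul_eq_mul, smul_eq_mul, mul_left_comm]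

theorem mulL2_sub_left {b b' : Space n → ℂ} (hb : Measurable b) {M : ℝ} (hM : ∀ x, ‖b x‖ ≤ M)
    (hb' : Measurable b') {M' : ℝ} (hM' : ∀ x, ‖b' x‖ ≤ M') (f : L2 n) :
    mulL2 (fun x => b x - b' x) f = mulL2 b f - mulL2 b' f := by
  have hM'' : ∀ x, ‖b x - b' x‖ ≤ M + M' := fun x =>
    (norm_sub_le _ _).trans (add_le_add (hM x) (hM' x))
  ext1
  have hm : Measurable fun x => b x - b' x := hb.sub hb'
  filter_upwards [coeFn_mulL2 hb hM f, coeFn_mulL2 hb' hM' f, coeFn_mulL2 hm hM'' f,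
    Lp.coeFn_sub (mulL2 b f) (mulL2 b' f)] with x h1 h2 h3 h4
  rw [h4, Pi.sub_apply, h1, h2, ← sub_mul, h3]

/-- Multiplication by a bounded measurable function as a bounded operator. -/
noncomputable def mulL2CLM (b : Space n → ℂ) (hb : Measurable b) (M : ℝ) (hM : ∀ x, ‖b x‖ ≤ M) :
    L2 n →L[ℂ] L2 n :=
  LinearMap.mkContinuous
    { toFun := mulL2 b
      map_add' := mulL2_add hb hM
      map_smul' := mulL2_smul hb hM } M (norm_mulL2_le hb hM)

@[simp]
theorem mulL2CLM_apply (b : Space n → ℂ) (hb : Measurable b) (M : ℝ) (hM : ∀ x, ‖b x‖ ≤ M)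
    (f : L2 n) : mulL2CLM b hb M hM f = mulL2 b f := rfl

/-- Translation of `f ∈ L²`. -/
noncomputable def translate (h : Space n) : L2 n →ₗᵢ[ℂ] L2 n :=
  Lp.compMeasurePreservingₗᵢ ℂ (fun x => x + h) (measurePreserving_add_right volume h)

theorem coeFn_translate (h : Space n) (f : L2 n) :
    translate h f =ᵐ[volume] fun x => f (x + h) :=
  Lp.coeFn_compMeasurePreserving f (measurePreserving_add_right volume h)

/-- Discrete product rule: the difference of `bf` is `b(·+h)` times the difference of `f`, plus the
difference of `b` times `f`. -/
theorem norm_translate_mulL2_sub_le {b : Space n → ℂ} (hb : Measurable b) {M : ℝ}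
    (hM : ∀ x, ‖b x‖ ≤ M) {K : ℝ≥0} (hK : LipschitzWith K b) (h : Space n) (f : L2 n) :
    ‖translate h (mulL2 b f) - mulL2 b f‖ ≤ M * ‖translate h f - f‖ + K * ‖h‖ * ‖f‖ := by
  have hM0 : 0 ≤ M := (norm_nonneg _).trans (hM 0)
  have key := norm_le_sum_of_ae_le (Finset.univ : Finset (Fin 2))
    (translate h (mulL2 b f) - mulL2 b f) ![translate h f - f, f] ![M, K * ‖h‖]
    (by intro i _; fin_cases i <;> simp <;> positivity) ?_
  · simpa using key
  have hq : ∀ᵐ x : Space n, mulL2 b f (x + h) = b (x + h) * f (x + h) :=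
    (measurePreserving_add_right volume h).quasiMeasurePreserving.ae (coeFn_mulL2 hb hM f)
  filter_upwards [coeFn_mulL2 hb hM f, coeFn_translate h f, coeFn_translate h (mulL2 b f),
    Lp.coeFn_sub (translate h (mulL2 b f)) (mulL2 b f), Lp.coeFn_sub (translate h f) f, hq]
    with x h1 h2 h3 h4 h5 h6
  simp only [Fin.sum_univ_two, Matrix.cons_val_zero, Matrix.cons_val_one]
  rw [h4, h5, Pi.sub_apply, Pi.sub_apply, h3, h2, h1, h6]
  have : b (x + h) * f (x + h) - b x * f x
      = b (x + h) * (f (x + h) - f x) + (b (x + h) - b x) * f x := by ring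
  rw [this]
  refine (norm_add_le _ _).trans ?_
  rw [norm_mul, norm_mul]
  have hd : ‖b (x + h) - b x‖ ≤ K * ‖h‖ := by
    simpa [dist_eq_norm] using hK.dist_le_mul (x + h) x
  gcongr
  exact hM _

end L2Tools

/-! ### Translations and derivatives on the Fourier side. -/

section FourierRules

variable {n : ℕ}

/-- The character `ξ ↦ exp(2πi⟨h, ξ⟩)`. -/
noncomputable def character (h ξ : Space n) : ℂ :=
  Complex.exp (Complex.I * ((2 * Real.pi * inner ℝ h ξ : ℝ) : ℂ))

theorem measurable_character (h : Space n) : Measurable (character h) := by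
  unfold character
  fun_prop

theorem norm_character (h ξ : Space n) : ‖character h ξ‖ = 1 := by
  rw [character, Complex.norm_exp_I_mul_ofReal]

/-- Both sides are continuous in `f`, so Schwartz functions suffice; there it is a change of
variables. -/
theorem fourier_translate_eq (h : Space n) (f : L2 n) :
    𝓕 (translate h f) = mulL2 (character h) (𝓕 f) := by
  refine DenseRange.induction_on
    (p := fun f : L2 n => 𝓕 (translate h f) = mulL2 (character h) (𝓕 f))
    (SchwartzMap.denseRange_toLpCLM (p := 2) (F := ℂ) (E := Space n) (μ := volume)
      ENNReal.ofNat_ne_top) f ?_ ?_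
  · refine isClosed_eq ?_ ?_
    · exact (Lp.fourierTransformₗᵢ (Space n) ℂ).continuous.comp (translate h).continuous
    · exact (mulL2CLM (character h) (measurable_character h) 1
        (fun ξ => (norm_character h ξ).le)).continuous.comp
          (Lp.fourierTransformₗᵢ (Space n) ℂ).continuous
  · intro φ
    have h1 : translate h (SchwartzMap.toLpCLM ℝ ℂ 2 volume φ)
        = (φ.compSubConstCLM ℂ (-h)).toLp 2 := by
      ext1
      have hq := (measurePreserving_add_right volume h).quasiMeasurePreserving.ae
        (φ.coeFn_toLp 2 volume)
      filter_upwards [coeFn_translate h (φ.toLp 2), (φ.compSubConstCLM ℂ (-h)).coeFn_toLp 2, hq]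
        with x h1 h2 h3
      rw [h2, SchwartzMap.toLpCLM_apply, h1, h3]
      simp
    rw [h1, SchwartzMap.toLpCLM_apply, SchwartzMap.toLp_fourier_eq, SchwartzMap.toLp_fourier_eq]
    ext1
    filter_upwards [(𝓕 φ).coeFn_toLp 2, (𝓕 (φ.compSubConstCLM ℂ (-h))).coeFn_toLp 2,
      coeFn_mulL2 (measurable_character h) (fun ξ => (norm_character h ξ).le) ((𝓕 φ).toLp 2)]
      with ξ h2 h3 h4
    rw [h3, h4, h2, SchwartzMap.fourier_coe, SchwartzMap.fourier_coe]
    have h5 : (⇑(φ.compSubConstCLM ℂ (-h)) : Space n → ℂ) = ⇑φ ∘ fun v => v + h := by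
      ext x; simp
    have h6 := congrFun (VectorFourier.fourierIntegral_comp_add_right Real.fourierChar
      (volume : Measure (Space n)) (innerₗ (Space n)) (⇑φ) h) ξ
    rw [h5]
    refine h6.trans ?_
    rw [Circle.smul_def, smul_eq_mul, Real.fourierChar_apply, character]
    congr 2
    simp [mul_comm]

theorem coeFn_fourier_translate (h : Space n) (f : L2 n) :
    ⇑(𝓕 (translate h f) : L2 n) =ᵐ[volume] fun ξ => character h ξ * (𝓕 f : L2 n) ξ := by
  rw [fourier_translate_eq]
  exact coeFn_mulL2 (measurable_character h) (fun ξ => (norm_character h ξ).le) _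

/-- Distributional derivatives enter the estimates only through this almost everywhere identity. -/
theorem hasPartial_iff {j : Fin n} {f g : L2 n} :
    HasPartial j f g ↔
      ⇑(𝓕 g : L2 n) =ᵐ[volume] fun ξ => (2 * Real.pi * Complex.I) * (ξ j * (𝓕 f : L2 n) ξ) := by
  have hT : (inner ℝ · (EuclideanSpace.single j (1 : ℝ)) : Space n → ℝ).HasTemperateGrowth := by
    fun_prop
  have hT' : (fun ξ : Space n => (ξ j : ℂ)).HasTemperateGrowth := by
    simpa [EuclideanSpace.inner_single_right, Function.comp_def] using
      Function.HasTemperateGrowth.comp (g := Complex.ofReal) (by fun_prop) hT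
  have h1 : HasPartial j f g ↔ ∀ u : 𝓢(Space n, ℂ),
      (2 * Real.pi * Complex.I) * ∫ ξ, (ξ j * u ξ) * (𝓕 f : L2 n) ξ
        = ∫ ξ, u ξ * (𝓕 g : L2 n) ξ := by
    have h2 : HasPartial j f g ↔
        𝓕 (∂_{(EuclideanSpace.single j (1 : ℝ) : Space n)} (f : 𝓢'(Space n, ℂ)))
          = 𝓕 (g : 𝓢'(Space n, ℂ)) := by
      constructor
      · intro h
        rw [h]
      · intro h
        have := congrArg (fun T => 𝓕⁻ T) h
        simpa [HasPartial] using this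
    rw [h2, TemperedDistribution.fourier_lineDerivOp_eq, Lp.fourier_toTemperedDistribution_eq,
      Lp.fourier_toTemperedDistribution_eq]
    constructor
    · intro h u
      have := DFunLike.congr_fun h u
      simpa [SchwartzMap.smulLeftCLM_apply_apply hT', EuclideanSpace.inner_single_right] using this
    · intro h
      ext u
      simpa [SchwartzMap.smulLeftCLM_apply_apply hT', EuclideanSpace.inner_single_right] using h u
  rw [h1]
  constructor
  · intro h
    -- A priori `ξ_j 𝓕f` is only locally integrable, which is enough for testing against compactly
    -- supported smooth functions.
    refine ae_eq_of_integral_contDiff_smul_eq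
      ((Lp.memLp (𝓕 g)).locallyIntegrable (by norm_num)) ?_ ?_
    · refine LocallyIntegrable.congr
        (f := fun ξ : Space n => ((2 * Real.pi * Complex.I) * (ξ j : ℂ)) • (𝓕 f : L2 n) ξ) ?_ ?_
      · rw [← locallyIntegrableOn_univ]
        refine LocallyIntegrableOn.continuousOn_smul isOpen_univ.isLocallyClosed ?_ ?_
        · exact locallyIntegrableOn_univ.2 ((Lp.memLp _).locallyIntegrable (by norm_num))
        · fun_prop
      · filter_upwards with ξ
        simp [mul_assoc]
    · intro u hu hc
      have hg₁ : HasCompactSupport (Complex.ofRealCLM ∘ u) := hc.comp_left rfl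
      have hg₂ : ContDiff ℝ ∞ (Complex.ofRealCLM ∘ u) := by fun_prop
      have := h (hg₁.toSchwartzMap hg₂)
      simp only [HasCompactSupport.toSchwartzMap_toFun, Function.comp_apply,
        Complex.ofRealCLM_apply] at this
      simp only [Complex.real_smul]
      rw [← this, ← integral_const_mul]
      congr 1 with ξ
      ring
  · intro h u
    rw [← integral_const_mul]
    refine integral_congr_ae ?_
    filter_upwards [h] with ξ hξ
    rw [hξ]
    ring

end FourierRules

/-! ### Supports and partial sums of the dyadic symbols. -/

section Symbols

variable {n : ℕ} {χ : ℝ → ℝ}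

theorem IsCutoff.continuous_symbol (hχ : IsCutoff χ) (k : ℤ) :
    Continuous (symbol χ k : Space n → ℂ) := by
  have := hχ.smooth.continuous
  unfold symbol
  fun_prop

theorem IsCutoff.norm_symbol_le (hχ : IsCutoff χ) (k : ℤ) (ξ : Space n) : ‖symbol χ k ξ‖ ≤ 1 := by
  rw [symbol, Complex.norm_real, Real.norm_eq_abs, abs_of_nonneg (hχ.nonneg _)]
  exact hχ.le_one _

theorem IsCutoff.symbol_eq_one (hχ : IsCutoff χ) {k : ℤ} {ξ : Space n}
    (h : ‖(2 * Real.pi) • ξ‖ ≤ 11 / 10 * 2 ^ k) : symbol χ k ξ = 1 := by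
  rw [symbol, hχ.eq_one, Complex.ofReal_one]
  rw [abs_of_nonneg (by positivity), zpow_neg, inv_mul_le_iff₀ (by positivity)]
  linarith

theorem IsCutoff.symbol_eq_zero (hχ : IsCutoff χ) {k : ℤ} {ξ : Space n}
    (h : 19 / 10 * 2 ^ k ≤ ‖(2 * Real.pi) • ξ‖) : symbol χ k ξ = 0 := by
  rw [symbol, hχ.eq_zero, Complex.ofReal_zero]
  rw [abs_of_nonneg (by positivity), zpow_neg, le_inv_mul_iff₀ (by positivity)]
  linarith

/-- The symbol of `Δ_k`. -/
noncomputable def blockSymbol (χ : ℝ → ℝ) (k : ℕ) (ξ : Space n) : ℂ :=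
  symbol χ k ξ - if k = 0 then 0 else symbol χ ((k : ℤ) - 1) ξ

theorem IsCutoff.measurable_blockSymbol (hχ : IsCutoff χ) (k : ℕ) :
    Measurable (blockSymbol χ k : Space n → ℂ) := by
  unfold blockSymbol
  split_ifs
  · exact (hχ.continuous_symbol _).measurable.sub measurable_const
  · exact (hχ.continuous_symbol _).measurable.sub (hχ.continuous_symbol _).measurable

theorem IsCutoff.norm_blockSymbol_le (hχ : IsCutoff χ) (k : ℕ) (ξ : Space n) :
    ‖blockSymbol χ k ξ‖ ≤ 1 := by
  unfold blockSymbol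
  split_ifs
  · simpa using hχ.norm_symbol_le k ξ
  · rw [symbol, symbol, ← Complex.ofReal_sub, Complex.norm_real, Real.norm_eq_abs, abs_le]
    constructor <;> linarith [hχ.nonneg (2 ^ (-(k : ℤ)) * ‖(2 * Real.pi) • ξ‖),
      hχ.le_one (2 ^ (-(k : ℤ)) * ‖(2 * Real.pi) • ξ‖),
      hχ.nonneg (2 ^ (-((k : ℤ) - 1)) * ‖(2 * Real.pi) • ξ‖),
      hχ.le_one (2 ^ (-((k : ℤ) - 1)) * ‖(2 * Real.pi) • ξ‖)]

theorem IsCutoff.norm_lt_of_blockSymbol_ne_zero (hχ : IsCutoff χ) {k : ℕ} {ξ : Space n}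
    (h : blockSymbol χ k ξ ≠ 0) : ‖(2 * Real.pi) • ξ‖ < 19 / 10 * 2 ^ k := by
  contrapose! h
  rw [blockSymbol, hχ.symbol_eq_zero (by simpa using h)]
  split_ifs
  · simp
  · rw [hχ.symbol_eq_zero, sub_zero]
    refine le_trans ?_ h
    have : (2 : ℝ) ^ ((k : ℤ) - 1) ≤ 2 ^ (k : ℤ) :=
      zpow_le_zpow_right₀ (by norm_num) (by linarith)
    simp only [zpow_natCast] at this
    linarith

theorem IsCutoff.lt_norm_of_blockSymbol_ne_zero (hχ : IsCutoff χ) {k : ℕ} (hk : k ≠ 0)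
    {ξ : Space n} (h : blockSymbol χ k ξ ≠ 0) : 11 / 20 * 2 ^ k < ‖(2 * Real.pi) • ξ‖ := by
  contrapose! h
  have h2 : (2 : ℝ) ^ ((k : ℤ) - 1) = 2 ^ k / 2 := by
    rw [zpow_sub₀ (by norm_num)]; simp
  have hp : (0 : ℝ) < 2 ^ k := by positivity
  rw [blockSymbol, if_neg hk, hχ.symbol_eq_one, hχ.symbol_eq_one, sub_self]
  · rw [h2]; linarith
  · rw [zpow_natCast]; linarith

theorem sum_range_blockSymbol (K : ℕ) (ξ : Space n) :
    ∑ k ∈ Finset.range (K + 1), blockSymbol χ k ξ = symbol χ K ξ := by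
  induction K with
  | zero => simp [blockSymbol]
  | succ K ih => rw [Finset.sum_range_succ, ih, blockSymbol]; simp

theorem IsCutoff.sum_blockSymbol_eq_one (hχ : IsCutoff χ) {K : ℕ} {ξ : Space n}
    (h : ‖(2 * Real.pi) • ξ‖ ≤ 11 / 10 * 2 ^ K) {F : Finset ℕ} (hF : Finset.range (K + 1) ⊆ F) :
    ∑ k ∈ F, blockSymbol χ k ξ = 1 := by
  rw [← Finset.sum_subset hF, sum_range_blockSymbol, hχ.symbol_eq_one (by simpa using h)]
  intro k _ hk
  by_contra h0
  have hK : K + 1 ≤ k := by simpa using hk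
  have h1 := hχ.lt_norm_of_blockSymbol_ne_zero (by omega) h0
  have h2 : (2 : ℝ) ^ (K + 1) ≤ 2 ^ k := pow_le_pow_right₀ (by norm_num) hK
  rw [pow_succ] at h2
  linarith

/-- At each frequency at most two consecutive symbols are nonzero, since `11/20 * 4 > 19/10`.
Bounding arbitrary finite sums, not only initial ones, is what gives unconditional convergence. -/
theorem IsCutoff.norm_sum_blockSymbol_le (hχ : IsCutoff χ) (F : Finset ℕ) (ξ : Space n) :
    ‖∑ k ∈ F, blockSymbol χ k ξ‖ ≤ 2 := by
  by_cases hS : ∃ k, blockSymbol χ k ξ ≠ 0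
  swap
  · push Not at hS
    simp [hS]
  classical
  let p := Nat.find hS
  have hp : blockSymbol χ p ξ ≠ 0 := Nat.find_spec hS
  have h1 := hχ.norm_lt_of_blockSymbol_ne_zero hp
  have hz : ∀ k, k ≠ p → k ≠ p + 1 → blockSymbol χ k ξ = 0 := by
    intro k hk hk'
    rcases lt_or_ge k p with hlt | hge
    · simpa using Nat.find_min hS hlt
    · by_contra h0
      have h2 := hχ.lt_norm_of_blockSymbol_ne_zero (by omega) h0
      have h3 : (2 : ℝ) ^ (p + 2) ≤ 2 ^ k := pow_le_pow_right₀ (by norm_num) (by omega)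
      have h4 : (0 : ℝ) < 2 ^ p := by positivity
      rw [pow_add] at h3
      linarith
  have hsub : ∑ k ∈ F, ‖blockSymbol χ k ξ‖ ≤ ∑ k ∈ {p, p + 1}, ‖blockSymbol χ k ξ‖ := by
    rw [← Finset.sum_filter_of_ne (p := fun k => k ∈ ({p, p + 1} : Finset ℕ))]
    · exact Finset.sum_le_sum_of_subset_of_nonneg (fun k hk => (Finset.mem_filter.1 hk).2)
        fun _ _ _ => norm_nonneg _
    · intro k _ hk
      by_contra hmem
      simp only [Finset.mem_insert, Finset.mem_singleton, not_or] at hmem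
      exact hk (by rw [hz k hmem.1 hmem.2, norm_zero])
  refine (norm_sum_le _ _).trans (hsub.trans ?_)
  rw [Finset.sum_pair (by omega)]
  linarith [hχ.norm_blockSymbol_le p ξ, hχ.norm_blockSymbol_le (p + 1) ξ]

end Symbols

/-! ### The Littlewood-Paley decomposition in `L²`. -/

section Blocks

variable {n : ℕ} {χ : ℝ → ℝ}

theorem lowFreq_of_neg {k : ℤ} (hk : k < 0) (f : L2 n) : lowFreq χ k f = 0 := if_pos hk

theorem IsCutoff.block_eq (hχ : IsCutoff χ) (k : ℕ) (f : L2 n) :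
    block χ k f = 𝓕⁻ (mulL2 (blockSymbol χ k) (𝓕 f)) := by
  rw [block, lowFreq, if_neg (by omega)]
  rcases Nat.eq_zero_or_pos k with rfl | hk
  · rw [lowFreq_of_neg (by simp), sub_zero]
    congr 2
    ext ξ
    simp [blockSymbol]
  · rw [lowFreq, if_neg (by omega)]
    have : (blockSymbol χ k : Space n → ℂ) = fun ξ => symbol χ k ξ - symbol χ ((k : ℤ) - 1) ξ := by
      ext ξ
      rw [blockSymbol, if_neg hk.ne']
    rw [this, mulL2_sub_left (hχ.continuous_symbol _).measurable (hχ.norm_symbol_le _)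
      (hχ.continuous_symbol _).measurable (hχ.norm_symbol_le _)]
    exact ((Lp.fourierTransformₗᵢ (Space n) ℂ).symm.map_sub _ _).symm

theorem IsCutoff.coeFn_fourier_block (hχ : IsCutoff χ) (k : ℕ) (f : L2 n) :
    ⇑(𝓕 (block χ k f) : L2 n) =ᵐ[volume] fun ξ => blockSymbol χ k ξ * (𝓕 f : L2 n) ξ := by
  rw [hχ.block_eq, fourier_fourierInv_eq]
  exact coeFn_mulL2 (hχ.measurable_blockSymbol k) (hχ.norm_blockSymbol_le k) _

/-- `Δ_k` as a bounded operator on `L²`. -/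
noncomputable def IsCutoff.blockCLM (hχ : IsCutoff χ) (k : ℕ) : L2 n →L[ℂ] L2 n :=
  ((Lp.fourierTransformₗᵢ (Space n) ℂ).symm : L2 n →L[ℂ] L2 n) ∘L
    mulL2CLM (blockSymbol χ k) (hχ.measurable_blockSymbol k) 1 (hχ.norm_blockSymbol_le k) ∘L
    ((Lp.fourierTransformₗᵢ (Space n) ℂ) : L2 n →L[ℂ] L2 n)

theorem IsCutoff.blockCLM_apply (hχ : IsCutoff χ) (k : ℕ) (f : L2 n) :
    hχ.blockCLM k f = block χ k f := by
  rw [hχ.block_eq]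
  rfl

theorem IsCutoff.norm_block_le (hχ : IsCutoff χ) (k : ℕ) (f : L2 n) : ‖block χ k f‖ ≤ ‖f‖ := by
  rw [← Lp.norm_fourier_eq (block χ k f), ← Lp.norm_fourier_eq f, hχ.block_eq,
    fourier_fourierInv_eq]
  simpa using norm_mulL2_le (hχ.measurable_blockSymbol k) (hχ.norm_blockSymbol_le k) (𝓕 f : L2 n)

theorem sum_range_block (K : ℕ) (f : L2 n) :
    ∑ k ∈ Finset.range (K + 1), block χ k f = lowFreq χ K f := by
  induction K with
  | zero => simp [block, lowFreq_of_neg]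
  | succ K ih => rw [Finset.sum_range_succ, ih, block]; simp

/-- Dominated convergence on the Fourier side along the finite sets of indices: the partial sums of
symbols are bounded by `2` and eventually equal `1` at each frequency. -/
theorem IsCutoff.hasSum_block (hχ : IsCutoff χ) (f : L2 n) :
    HasSum (fun k => block χ k f) f := by
  suffices h : HasSum (fun k => mulL2 (blockSymbol χ k) (𝓕 f : L2 n)) (𝓕 f : L2 n) by
    have h1 := h.mapL ((Lp.fourierTransformₗᵢ (Space n) ℂ).symm : L2 n →L[ℂ] L2 n)
    have h2 : HasSum (fun k => (𝓕⁻ (mulL2 (blockSymbol χ k) (𝓕 f : L2 n)) : L2 n))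
      (𝓕⁻ (𝓕 f : L2 n) : L2 n) := h1
    simp_rw [hχ.block_eq]
    rwa [fourierInv_fourier_eq] at h2
  set g : L2 n := 𝓕 f
  rw [HasSum, SummationFilter.unconditional_filter, Lp.tendsto_Lp_iff_tendsto_eLpNorm']
  have hae : ∀ F : Finset ℕ, ⇑(∑ k ∈ F, mulL2 (blockSymbol χ k) g) - ⇑g =ᵐ[volume]
      fun ξ => (∑ k ∈ F, blockSymbol χ k ξ - 1) * g ξ := by
    intro F
    have hall : ∀ᵐ ξ, ∀ k, mulL2 (blockSymbol χ k) g ξ = blockSymbol χ k ξ * g ξ :=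
      ae_all_iff.2 fun k => coeFn_mulL2 (hχ.measurable_blockSymbol k) (hχ.norm_blockSymbol_le k) g
    filter_upwards [hall, Lp.coeFn_finsetSum F fun k => mulL2 (blockSymbol χ k) g] with ξ h1 h2
    rw [Pi.sub_apply, h2]
    simp [h1, Finset.sum_mul, sub_mul]
  simp_rw [eLpNorm_congr_ae (hae _)]
  simp_rw [eLpNorm_eq_lintegral_rpow_enorm_toReal (p := 2) (by norm_num) (by norm_num)]
  rw [show (0 : ℝ≥0∞) = 0 ^ (1 / (2 : ℝ≥0∞).toReal) by simp]
  refine Filter.Tendsto.ennrpow_const _ ?_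
  have hlim := tendsto_lintegral_filter_of_dominated_convergence' (μ := (volume : Measure (Space n)))
    (l := Filter.atTop) (F := fun (F : Finset ℕ) ξ =>
      ‖(∑ k ∈ F, blockSymbol χ k ξ - 1) * g ξ‖ₑ ^ (2 : ℝ≥0∞).toReal) (f := fun _ => 0)
    (fun ξ => 9 * ‖g ξ‖ₑ ^ (2 : ℝ≥0∞).toReal) ?_ ?_ ?_ ?_
  · simpa using hlim
  · refine Filter.Eventually.of_forall fun F => ?_
    refine AEMeasurable.pow_const (AEMeasurable.enorm ?_) _
    refine AEMeasurable.mul (Measurable.aemeasurable ?_) (Lp.aestronglyMeasurable g).aemeasurable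
    exact (Finset.measurable_fun_sum F fun k _ => hχ.measurable_blockSymbol k).sub measurable_const
  · refine Filter.Eventually.of_forall fun F => Filter.Eventually.of_forall fun ξ => ?_
    have h3 : ‖∑ k ∈ F, blockSymbol χ k ξ - 1‖ₑ ≤ 3 := by
      rw [← ofReal_norm, show (3 : ℝ≥0∞) = ENNReal.ofReal 3 by simp]
      refine ENNReal.ofReal_le_ofReal ((norm_sub_le _ _).trans ?_)
      rw [norm_one]
      linarith [hχ.norm_sum_blockSymbol_le F ξ]
    simp only [ENNReal.toReal_ofNat, ENNReal.rpow_ofNat, enorm_mul, mul_pow]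
    gcongr
    calc _ ≤ (3 : ℝ≥0∞) ^ 2 := by gcongr
      _ = 9 := by norm_num
  · rw [lintegral_const_mul' _ _ (by norm_num)]
    refine ENNReal.mul_ne_top (by norm_num) ?_
    exact ((eLpNorm_lt_top_iff_lintegral_rpow_enorm_lt_top (by norm_num) (by norm_num)).1
      (Lp.eLpNorm_lt_top g)).ne
  · refine Filter.Eventually.of_forall fun ξ => ?_
    refine tendsto_const_nhds.congr' ?_
    obtain ⟨K, hK⟩ := pow_unbounded_of_one_lt (‖(2 * Real.pi) • ξ‖) (one_lt_two (α := ℝ))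
    filter_upwards [Filter.eventually_ge_atTop (Finset.range (K + 1))] with F hF
    rw [hχ.sum_blockSymbol_eq_one (by linarith [norm_nonneg ((2 * Real.pi) • ξ)]) hF]
    simp

end Blocks

/-! ### Convolution kernels and low-frequency cutoffs of Lipschitz functions. -/

section Kernel

variable {n : ℕ} {χ : ℝ → ℝ}

/-- The norm is not smooth at the origin, but the symbol is constant near it. -/
theorem IsCutoff.contDiff_symbol (hχ : IsCutoff χ) (k : ℤ) :
    ContDiff ℝ ∞ (symbol χ k : Space n → ℂ) := by
  rw [contDiff_iff_contDiffAt]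
  intro ξ
  by_cases h0 : ξ = 0
  · subst h0
    refine (contDiffAt_const (c := (1 : ℂ))).congr_of_eventuallyEq ?_
    have hc : Continuous fun ξ : Space n => ‖(2 * Real.pi) • ξ‖ := by fun_prop
    have hlt : ∀ᶠ ξ : Space n in nhds 0, ‖(2 * Real.pi) • ξ‖ < 11 / 10 * 2 ^ k :=
      hc.continuousAt.eventually_lt continuousAt_const (by simp; positivity)
    filter_upwards [hlt] with ξ hξ
    exact hχ.symbol_eq_one hξ.le
  · have h1 : ContDiffAt ℝ ∞ (fun ξ : Space n => (2 : ℝ) ^ (-k) * ‖(2 * Real.pi) • ξ‖) ξ := by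
      refine contDiffAt_const.mul (ContDiffAt.norm ℝ (by fun_prop) ?_)
      exact smul_ne_zero (by positivity) h0
    exact Complex.ofRealCLM.contDiff.contDiffAt.comp ξ (hχ.smooth.contDiffAt.comp ξ h1)

theorem IsCutoff.hasCompactSupport_symbol (hχ : IsCutoff χ) (k : ℤ) :
    HasCompactSupport (symbol χ k : Space n → ℂ) := by
  refine HasCompactSupport.intro (isCompact_closedBall (0 : Space n) (2 * 2 ^ k)) ?_
  intro ξ hξ
  refine hχ.symbol_eq_zero ?_
  rw [Metric.mem_closedBall, dist_zero_right, not_le] at hξ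
  rw [norm_smul, Real.norm_of_nonneg (by positivity)]
  have h2 : (0 : ℝ) < 2 ^ k := by positivity
  nlinarith [Real.pi_gt_three, norm_nonneg ξ]

/-- The convolution kernel `𝓕⁻¹(χ_k)` of `S_k`. -/
noncomputable def IsCutoff.kernel (hχ : IsCutoff χ) (n : ℕ) (k : ℤ) : 𝓢(Space n, ℂ) :=
  𝓕⁻ ((hχ.hasCompactSupport_symbol k).toSchwartzMap (hχ.contDiff_symbol k))

theorem IsCutoff.coe_kernel (hχ : IsCutoff χ) (k : ℤ) :
    ⇑(hχ.kernel n k) = 𝓕⁻ (symbol χ k : Space n → ℂ) := by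
  rw [IsCutoff.kernel, SchwartzMap.fourierInv_coe]
  rfl

theorem IsCutoff.integral_kernel (hχ : IsCutoff χ) (k : ℤ) : ∫ y, hχ.kernel n k y = 1 := by
  have h1 : 𝓕 (hχ.kernel n k)
      = (hχ.hasCompactSupport_symbol k).toSchwartzMap (hχ.contDiff_symbol k) :=
    fourier_fourierInv_eq _
  have h2 := congrArg (fun φ : 𝓢(Space n, ℂ) => φ 0) h1
  simp only [SchwartzMap.fourier_coe, HasCompactSupport.toSchwartzMap_toFun, Real.fourier_eq] at h2
  rw [hχ.symbol_eq_one (by simp; positivity)] at h2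
  simpa using h2

/-- By this scaling the kernels share one `L¹` norm, and their first moments are proportional to
`2^{-k}`. -/
theorem IsCutoff.kernel_apply (hχ : IsCutoff χ) (k : ℤ) (y : Space n) :
    hχ.kernel n k y = (((2 : ℝ) ^ k) ^ n : ℝ) • hχ.kernel n 0 ((2 : ℝ) ^ k • y) := by
  rw [hχ.coe_kernel, hχ.coe_kernel, Real.fourierInv_eq, Real.fourierInv_eq]
  have h := Measure.integral_comp_smul (volume : Measure (Space n))
    (fun v => Real.fourierChar (inner ℝ v ((2 : ℝ) ^ k • y)) • symbol χ 0 v) ((2 : ℝ) ^ (-k))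
  rw [finrank_euclideanSpace_fin] at h
  have h3 : |(((2 : ℝ) ^ (-k)) ^ n)⁻¹| = ((2 : ℝ) ^ k) ^ n := by
    rw [abs_of_pos (by positivity), zpow_neg, inv_pow, inv_inv]
  rw [h3] at h
  rw [← h]
  congr 1 with v
  have h4 : symbol χ k v = symbol χ 0 ((2 : ℝ) ^ (-k) • v) := by
    rw [symbol, symbol, smul_comm, norm_smul _ ((2 * Real.pi) • v),
      Real.norm_of_nonneg (by positivity)]
    simp
  have h5 : (inner ℝ ((2 : ℝ) ^ (-k) • v) ((2 : ℝ) ^ k • y) : ℝ) = inner ℝ v y := by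
    rw [inner_smul_left, inner_smul_right, ← mul_assoc, RCLike.conj_to_real, zpow_neg,
      inv_mul_cancel₀ (by positivity), one_mul]
  rw [h4, h5]

theorem IsCutoff.integral_norm_kernel (hχ : IsCutoff χ) (k : ℤ) :
    ∫ y, ‖hχ.kernel n k y‖ = ∫ y, ‖hχ.kernel n 0 y‖ := by
  have h := Measure.integral_comp_smul (volume : Measure (Space n))
    (fun y => ‖hχ.kernel n 0 y‖) ((2 : ℝ) ^ k)
  rw [finrank_euclideanSpace_fin, abs_of_pos (by positivity), smul_eq_mul,
    eq_inv_mul_iff_mul_eq₀ (by positivity)] at h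
  rw [← h, ← integral_const_mul]
  congr 1 with y
  rw [hχ.kernel_apply k, norm_smul, Real.norm_of_nonneg (by positivity)]

theorem IsCutoff.integral_norm_mul_norm_kernel (hχ : IsCutoff χ) (k : ℤ) :
    ∫ y, ‖y‖ * ‖hχ.kernel n k y‖ = 2 ^ (-k) * ∫ y, ‖y‖ * ‖hχ.kernel n 0 y‖ := by
  have h := Measure.integral_comp_smul (volume : Measure (Space n))
    (fun y => ‖y‖ * ‖hχ.kernel n 0 y‖) ((2 : ℝ) ^ k)
  rw [finrank_euclideanSpace_fin, abs_of_pos (by positivity), smul_eq_mul,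
    eq_inv_mul_iff_mul_eq₀ (by positivity)] at h
  rw [← h, ← integral_const_mul, ← integral_const_mul]
  congr 1 with y
  have h2 : (2 : ℝ) ^ k ≠ 0 := by positivity
  rw [hχ.kernel_apply k, norm_smul, norm_smul, Real.norm_of_nonneg (by positivity),
    Real.norm_of_nonneg (by positivity), zpow_neg]
  field_simp

theorem IsCutoff.lowFreqFun_eq (hχ : IsCutoff χ) {k : ℤ} (hk : 0 ≤ k) (a : Space n → ℂ)
    (x : Space n) : lowFreqFun χ k a x = ∫ y, hχ.kernel n k y * a (x - y) := by
  rw [lowFreqFun, if_neg (by omega), hχ.coe_kernel]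

variable {a : Space n → ℂ} {A : ℝ≥0}

theorem IsCutoff.integrable_kernel_mul (hχ : IsCutoff χ) (k : ℤ) (hA : ∀ x, ‖a x‖ ≤ A)
    (ha : LipschitzWith A a) (x : Space n) :
    Integrable fun y => hχ.kernel n k y * a (x - y) := by
  refine (hχ.kernel n k).integrable.mul_bdd (c := A) ?_ ?_
  · have := ha.continuous
    exact (by fun_prop : Continuous fun y => a (x - y)).aestronglyMeasurable
  · exact Filter.Eventually.of_forall fun y => hA _

theorem IsCutoff.norm_lowFreqFun_le (hχ : IsCutoff χ) (k : ℤ) (hA : ∀ x, ‖a x‖ ≤ A)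
    (x : Space n) : ‖lowFreqFun χ k a x‖ ≤ (∫ y, ‖hχ.kernel n 0 y‖) * A := by
  rcases lt_or_ge k 0 with hk | hk
  · rw [lowFreqFun, if_pos hk, norm_zero]
    positivity
  · rw [hχ.lowFreqFun_eq hk, ← hχ.integral_norm_kernel k, ← integral_mul_const]
    refine norm_integral_le_of_norm_le ((hχ.kernel n k).integrable.norm.mul_const _)
      (Filter.Eventually.of_forall fun y => ?_)
    rw [norm_mul]
    exact mul_le_mul_of_nonneg_left (hA _) (norm_nonneg _)

theorem IsCutoff.norm_lowFreqFun_sub_le (hχ : IsCutoff χ) (k : ℤ) (hA : ∀ x, ‖a x‖ ≤ A)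
    (ha : LipschitzWith A a) (x x' : Space n) :
    ‖lowFreqFun χ k a x - lowFreqFun χ k a x'‖
      ≤ (∫ y, ‖hχ.kernel n 0 y‖) * A * ‖x - x'‖ := by
  rcases lt_or_ge k 0 with hk | hk
  · rw [lowFreqFun, lowFreqFun, if_pos hk, if_pos hk, sub_zero, norm_zero]
    positivity
  · rw [hχ.lowFreqFun_eq hk, hχ.lowFreqFun_eq hk, ← hχ.integral_norm_kernel k, mul_assoc,
      ← integral_mul_const, ← integral_sub (hχ.integrable_kernel_mul k hA ha x)
        (hχ.integrable_kernel_mul k hA ha x')]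
    refine norm_integral_le_of_norm_le ((hχ.kernel n k).integrable.norm.mul_const _)
      (Filter.Eventually.of_forall fun y => ?_)
    rw [← mul_sub, norm_mul]
    refine mul_le_mul_of_nonneg_left ?_ (norm_nonneg _)
    simpa [dist_eq_norm] using ha.dist_le_mul (x - y) (x' - y)

/-- The kernel has integral one, so the difference averages `a(x) - a(x - y)`, and the first moment
supplies `2^{-k}`. For `k < 0` the bound on `a` itself suffices, as `2^{-k} ≥ 1`. -/
theorem IsCutoff.norm_sub_lowFreqFun_le (hχ : IsCutoff χ) (k : ℤ) (hA : ∀ x, ‖a x‖ ≤ A)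
    (ha : LipschitzWith A a) (x : Space n) :
    ‖a x - lowFreqFun χ k a x‖
      ≤ (1 + ∫ y, ‖y‖ * ‖hχ.kernel n 0 y‖) * A * 2 ^ (-k) := by
  have hM : 0 ≤ ∫ y, ‖y‖ * ‖hχ.kernel n 0 y‖ := by positivity
  rcases lt_or_ge k 0 with hk | hk
  · rw [lowFreqFun, if_pos hk, sub_zero]
    have h1 : (1 : ℝ) ≤ 2 ^ (-k) := one_le_zpow₀ (by norm_num) (by omega)
    calc ‖a x‖ ≤ 1 * A * 1 := by simpa using hA x
      _ ≤ _ := by gcongr; linarith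
  · have h1 : a x = ∫ y, hχ.kernel n k y * a x := by
      rw [integral_mul_const, hχ.integral_kernel, one_mul]
    have h2 : a x - lowFreqFun χ k a x = ∫ y, hχ.kernel n k y * (a x - a (x - y)) := by
      conv_lhs => rw [h1]
      rw [hχ.lowFreqFun_eq hk, ← integral_sub ((hχ.kernel n k).integrable.mul_const _)
        (hχ.integrable_kernel_mul k hA ha x)]
      simp_rw [mul_sub]
    have h3 : ‖∫ y, hχ.kernel n k y * (a x - a (x - y))‖
        ≤ ∫ y, (‖y‖ * ‖hχ.kernel n k y‖) * A := by
      refine norm_integral_le_of_norm_le (Integrable.mul_const ?_ _)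
        (Filter.Eventually.of_forall fun y => ?_)
      · simpa using (hχ.kernel n k).integrable_pow_mul volume 1
      · rw [norm_mul]
        have := ha.dist_le_mul x (x - y)
        rw [dist_eq_norm, dist_eq_norm, sub_sub_cancel] at this
        calc _ ≤ ‖hχ.kernel n k y‖ * (A * ‖y‖) := by gcongr
          _ = _ := by ring
    rw [h2]
    refine h3.trans ?_
    rw [integral_mul_const, hχ.integral_norm_mul_norm_kernel k]
    have : (0 : ℝ) ≤ A * 2 ^ (-k) := by positivity
    nlinarith

/-- `S_k` maps Lipschitz functions to Lipschitz functions and approximates them at the rate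
`2^{-k}`. -/
theorem IsCutoff.exists_lowFreqFun_bounds (hχ : IsCutoff χ) (n : ℕ) :
    ∃ M : ℝ≥0, ∀ (a : Space n → ℂ) (A : ℝ≥0), (∀ x, ‖a x‖ ≤ A) → LipschitzWith A a → ∀ k : ℤ,
      (∀ x, ‖lowFreqFun χ k a x‖ ≤ M * A) ∧ LipschitzWith (M * A) (lowFreqFun χ k a) ∧
      LipschitzWith (M * A) (fun x => a x - lowFreqFun χ k a x) ∧
      ∀ x, ‖a x - lowFreqFun χ k a x‖ ≤ M * A * 2 ^ (-k) := by
  have h0 : 0 ≤ ∫ y, ‖hχ.kernel n 0 y‖ := by positivity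
  have h1 : 0 ≤ ∫ y, ‖y‖ * ‖hχ.kernel n 0 y‖ := by positivity
  set M0 := ∫ y, ‖hχ.kernel n 0 y‖
  set M1 := ∫ y, ‖y‖ * ‖hχ.kernel n 0 y‖
  have hM : ((1 + M0 + M1).toNNReal : ℝ) = 1 + M0 + M1 := Real.coe_toNNReal _ (by positivity)
  refine ⟨(1 + M0 + M1).toNNReal, fun a A hA ha k => ⟨fun x => ?_, ?_, ?_, fun x => ?_⟩⟩
  · refine (hχ.norm_lowFreqFun_le k hA x).trans ?_
    rw [hM]
    gcongr
    linarith
  · refine LipschitzWith.of_dist_le_mul fun x y => ?_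
    rw [dist_eq_norm, dist_eq_norm]
    refine (hχ.norm_lowFreqFun_sub_le k hA ha x y).trans ?_
    rw [NNReal.coe_mul, hM]
    gcongr
    linarith
  · refine LipschitzWith.of_dist_le_mul fun x y => ?_
    have h2 := hχ.norm_lowFreqFun_sub_le k hA ha x y
    have h3 := ha.dist_le_mul x y
    rw [dist_eq_norm] at h3 ⊢
    rw [dist_eq_norm] at h3 ⊢
    rw [sub_sub_sub_comm]
    refine (norm_sub_le _ _).trans ?_
    rw [NNReal.coe_mul, hM]
    have : (0 : ℝ) ≤ A * ‖x - y‖ := by positivity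
    nlinarith
  · refine (hχ.norm_sub_lowFreqFun_le k hA ha x).trans ?_
    rw [hM]
    gcongr
    linarith

end Kernel

/-! ### Bernstein inequalities and finite differences. -/

section Bernstein

variable {n : ℕ} {χ : ℝ → ℝ}

theorem norm_le_sum_of_ae_le_fourier {ι : Type*} (s : Finset ι) (f : L2 n) (g : ι → L2 n)
    (c : ι → ℝ) (hc : ∀ i ∈ s, 0 ≤ c i)
    (h : ∀ᵐ ξ, ‖(𝓕 f : L2 n) ξ‖ ≤ ∑ i ∈ s, c i * ‖(𝓕 (g i) : L2 n) ξ‖) :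
    ‖f‖ ≤ ∑ i ∈ s, c i * ‖g i‖ := by
  simpa using norm_le_sum_of_ae_le s (𝓕 f : L2 n) (fun i => (𝓕 (g i) : L2 n)) c hc h

theorem norm_le_mul_of_ae_le_fourier (f g : L2 n) {c : ℝ} (hc : 0 ≤ c)
    (h : ∀ᵐ ξ, ‖(𝓕 f : L2 n) ξ‖ ≤ c * ‖(𝓕 g : L2 n) ξ‖) : ‖f‖ ≤ c * ‖g‖ := by
  simpa using norm_le_mul_of_ae_le (𝓕 f : L2 n) (𝓕 g : L2 n) hc h

theorem norm_le_sum_abs (x : Space n) : ‖x‖ ≤ ∑ i, |x i| := by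
  conv_lhs => rw [← (EuclideanSpace.basisFun (Fin n) ℝ).sum_repr x]
  refine (norm_sum_le _ _).trans (Finset.sum_le_sum fun i _ => ?_)
  simp [norm_smul]

theorem abs_apply_le_norm (x : Space n) (i : Fin n) : |x i| ≤ ‖x‖ :=
  PiLp.norm_apply_le x i

theorem norm_two_pi_I_mul (ξ : Space n) (j : Fin n) (z : ℂ) :
    ‖(2 * Real.pi * Complex.I) * (ξ j * z)‖ = |((2 * Real.pi) • ξ) j| * ‖z‖ := by
  simp [abs_mul, mul_assoc]

theorem IsCutoff.exists_hasPartial_block (hχ : IsCutoff χ) (i : Fin n) (ν : ℕ) (f : L2 n) :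
    ∃ g, HasPartial i (block χ ν f) g ∧ ‖g‖ ≤ 2 * 2 ^ ν * ‖block χ ν f‖ := by
  let S : Set (Space n) := {ξ | ‖(2 * Real.pi) • ξ‖ < 19 / 10 * 2 ^ ν}
  have hS : MeasurableSet S := by
    refine measurableSet_lt ?_ measurable_const
    fun_prop
  -- Truncating the symbol of `∂_i` to a ball containing the support of `blockSymbol χ ν` makes it a
  -- bounded multiplier without changing its action on the block.
  let σ : Space n → ℂ := S.indicator fun ξ => (2 * Real.pi * Complex.I) * ξ i
  have hσ : Measurable σ := Measurable.indicator (by fun_prop) hS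
  have hσb : ∀ ξ, ‖σ ξ‖ ≤ 2 * 2 ^ ν := by
    intro ξ
    by_cases h : ξ ∈ S
    · have h1 := norm_two_pi_I_mul ξ i 1
      rw [mul_one, norm_one, mul_one] at h1
      have h2 : ‖(2 * Real.pi) • ξ‖ < 19 / 10 * 2 ^ ν := h
      simp only [σ, Set.indicator_of_mem h]
      rw [h1]
      have h3 : (0 : ℝ) < 2 ^ ν := by positivity
      linarith [abs_apply_le_norm ((2 * Real.pi) • ξ) i]
    · simp only [σ, Set.indicator_of_notMem h, norm_zero]
      positivity
  refine ⟨𝓕⁻ (mulL2 σ (𝓕 (block χ ν f))), ?_, ?_⟩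
  · rw [hasPartial_iff, fourier_fourierInv_eq]
    filter_upwards [hχ.coeFn_fourier_block ν f, coeFn_mulL2 hσ hσb (𝓕 (block χ ν f))] with ξ h1 h2
    rw [h2, h1]
    by_cases h : ξ ∈ S
    · simp only [σ, Set.indicator_of_mem h]
      ring
    · have : blockSymbol χ ν ξ = 0 := by
        by_contra h0
        exact h (hχ.norm_lt_of_blockSymbol_ne_zero h0)
      simp [this]
  · rw [← Lp.norm_fourier_eq, fourier_fourierInv_eq, ← Lp.norm_fourier_eq (block χ ν f)]
    exact norm_mulL2_le hσ hσb _

theorem IsCutoff.norm_block_partial_le (hχ : IsCutoff χ) {j : Fin n} {w u : L2 n}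
    (h : HasPartial j w u) (ν : ℕ) : ‖block χ ν u‖ ≤ 2 * 2 ^ ν * ‖block χ ν w‖ := by
  refine norm_le_mul_of_ae_le_fourier _ _ (by positivity) ?_
  filter_upwards [hχ.coeFn_fourier_block ν u, hχ.coeFn_fourier_block ν w, hasPartial_iff.1 h]
    with ξ h1 h2 h3
  rw [h1, h2, h3, norm_mul, norm_two_pi_I_mul, norm_mul]
  by_cases h0 : blockSymbol χ ν ξ = 0
  · simp [h0]
  · have h4 := hχ.norm_lt_of_blockSymbol_ne_zero h0
    have h5 := abs_apply_le_norm ((2 * Real.pi) • ξ) j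
    have h6 : (0 : ℝ) < 2 ^ ν := by positivity
    have h7 : |((2 * Real.pi) • ξ) j| ≤ 2 * 2 ^ ν := by linarith
    calc _ = |((2 * Real.pi) • ξ) j| * (‖blockSymbol χ ν ξ‖ * ‖(𝓕 w : L2 n) ξ‖) := by ring
      _ ≤ _ := by gcongr

/-- A crude bound, uniform in `ν`, used only for the summability of `2^{2ν} ‖v_ν‖²`. -/
theorem IsCutoff.two_pow_mul_norm_block_le (hχ : IsCutoff χ) {w : L2 n} {u : Fin n → L2 n}
    (h : ∀ j, HasPartial j w (u j)) (ν : ℕ) :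
    2 ^ ν * ‖block χ ν w‖ ≤ ‖w‖ + ∑ j, 2 * ‖u j‖ := by
  have hs : 0 ≤ ∑ j, 2 * ‖u j‖ := by positivity
  rcases Nat.eq_zero_or_pos ν with rfl | hν
  · simpa using (hχ.norm_block_le 0 w).trans (le_add_of_nonneg_right hs)
  have h0 : ‖(2 : ℂ) ^ ν • block χ ν w‖ ≤ ∑ j, 2 * ‖u j‖ := by
    refine norm_le_sum_of_ae_le_fourier _ _ _ _ (by simp) ?_
    have hall : ∀ᵐ ξ, ∀ j, (𝓕 (u j) : L2 n) ξ
        = (2 * Real.pi * Complex.I) * (ξ j * (𝓕 w : L2 n) ξ) :=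
      ae_all_iff.2 fun j => hasPartial_iff.1 (h j)
    rw [FourierTransform.fourier_smul]
    filter_upwards [hχ.coeFn_fourier_block ν w, hall,
      Lp.coeFn_smul ((2 : ℂ) ^ ν) (𝓕 (block χ ν w) : L2 n)] with ξ h1 h2 h3
    rw [h3, Pi.smul_apply, h1]
    simp only [h2, norm_two_pi_I_mul]
    by_cases hb : blockSymbol χ ν ξ = 0
    · rw [hb]
      simp only [zero_mul, smul_zero, norm_zero]
      positivity
    have h4 := hχ.lt_norm_of_blockSymbol_ne_zero hν.ne' hb
    have h5 := norm_le_sum_abs ((2 * Real.pi) • ξ)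
    have h6 := hχ.norm_blockSymbol_le ν ξ
    have hp : (0 : ℝ) < 2 ^ ν := by positivity
    have h7 : (2 : ℝ) ^ ν ≤ 2 * ∑ j, |((2 * Real.pi) • ξ) j| := by linarith
    rw [norm_smul, norm_mul, norm_pow, Complex.norm_ofNat]
    calc (2 : ℝ) ^ ν * (‖blockSymbol χ ν ξ‖ * ‖(𝓕 w : L2 n) ξ‖)
        ≤ (2 * ∑ j, |((2 * Real.pi) • ξ) j|) * (1 * ‖(𝓕 w : L2 n) ξ‖) := by gcongr
      _ = _ := by rw [Finset.mul_sum, Finset.sum_mul]; simp [mul_assoc]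
  rw [norm_smul, norm_pow, Complex.norm_ofNat] at h0
  linarith [norm_nonneg w]

theorem coeFn_fourier_translate_sub (h : Space n) (f : L2 n) :
    ⇑(𝓕 (translate h f - f) : L2 n) =ᵐ[volume] fun ξ => (character h ξ - 1) * (𝓕 f : L2 n) ξ := by
  have h0 : (𝓕 (translate h f - f) : L2 n) = 𝓕 (translate h f) - 𝓕 f :=
    (Lp.fourierTransformₗᵢ (Space n) ℂ).map_sub _ _
  rw [h0]
  filter_upwards [coeFn_fourier_translate h f,
    Lp.coeFn_sub (𝓕 (translate h f) : L2 n) (𝓕 f)] with ξ h1 h2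
  rw [h2, Pi.sub_apply, h1, sub_mul, one_mul]

theorem norm_character_sub_one_le (h ξ : Space n) :
    ‖character h ξ - 1‖ ≤ ‖h‖ * ‖(2 * Real.pi) • ξ‖ := by
  refine Real.norm_exp_I_mul_ofReal_sub_one_le.trans ?_
  rw [← inner_smul_right]
  exact norm_inner_le_norm _ _

theorem IsCutoff.norm_translate_block_sub_le (hχ : IsCutoff χ) (h : Space n) (k : ℕ) (f : L2 n) :
    ‖translate h (block χ k f) - block χ k f‖ ≤ 2 * 2 ^ k * ‖h‖ * ‖block χ k f‖ := by
  refine norm_le_mul_of_ae_le_fourier _ _ (by positivity) ?_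
  filter_upwards [hχ.coeFn_fourier_block k f, coeFn_fourier_translate_sub h (block χ k f)]
    with ξ h1 h2
  rw [h2, h1]
  by_cases h0 : blockSymbol χ k ξ = 0
  · simp [h0]
  rw [norm_mul]
  gcongr
  have h3 := hχ.norm_lt_of_blockSymbol_ne_zero h0
  have h4 : (0 : ℝ) < 2 ^ k := by positivity
  calc _ ≤ ‖h‖ * ‖(2 * Real.pi) • ξ‖ := norm_character_sub_one_le h ξ
    _ ≤ ‖h‖ * (2 * 2 ^ k) := by gcongr; linarith
    _ = _ := by ring

/-- The left side of `|e^{iθ} - 1| = 2|sin(θ/2)|` is bounded below by Jordan's inequality, with `2/π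
≥ 3/5`. -/
theorem le_norm_exp_I_mul_sub_one {θ : ℝ} (h : |θ| ≤ 2) :
    3 / 5 * |θ| ≤ ‖Complex.exp (Complex.I * θ) - 1‖ := by
  rw [Complex.norm_exp_I_mul_ofReal_sub_one, norm_mul, Real.norm_eq_abs, Real.norm_eq_abs]
  have h2 : |θ / 2| ≤ Real.pi / 2 := by
    rw [abs_div, abs_two]
    linarith [Real.pi_gt_three]
  have h1 := Real.mul_abs_le_abs_sin h2
  rw [abs_div, abs_two] at h1
  have h3 : 3 / 5 ≤ 2 / Real.pi := by
    rw [div_le_div_iff₀ (by norm_num) Real.pi_pos]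
    linarith [Real.pi_lt_d2]
  rw [abs_two]
  have := mul_le_mul_of_nonneg_right h3 (show 0 ≤ |θ| / 2 by positivity)
  linarith

/-- On the support of the symbol the angular frequency has norm between `11/20 * 2^ν` and `19/10 *
2^ν`. Steps `2^{-ν}` along the axes thus produce phases of modulus at most `2`, and the moduli of
the difference symbols add up to at least `3/5 * 11/20 > 1/4`, whence the factor `4`. For `ν = 0`
there is no lower frequency bound. -/
theorem IsCutoff.norm_block_le_sum_translate (hχ : IsCutoff χ) {ν : ℕ} (hν : ν ≠ 0) (g : L2 n) :
    ‖block χ ν g‖ ≤ ∑ i : Fin n,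
      4 * ‖translate (EuclideanSpace.single i ((2 ^ ν)⁻¹ : ℝ)) g - g‖ := by
  refine norm_le_sum_of_ae_le_fourier _ _ _ _ (by simp) ?_
  have hall : ∀ᵐ ξ, ∀ i : Fin n,
      (𝓕 (translate (EuclideanSpace.single i ((2 ^ ν)⁻¹ : ℝ)) g - g) : L2 n) ξ
        = (character (EuclideanSpace.single i ((2 ^ ν)⁻¹ : ℝ)) ξ - 1) * (𝓕 g : L2 n) ξ :=
    ae_all_iff.2 fun i => coeFn_fourier_translate_sub _ g
  filter_upwards [hχ.coeFn_fourier_block ν g, hall] with ξ h1 h2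
  rw [h1]
  simp only [h2, norm_mul, ← mul_assoc]
  rw [← Finset.sum_mul]
  gcongr
  by_cases h0 : blockSymbol χ ν ξ = 0
  · rw [h0, norm_zero]
    positivity
  refine (hχ.norm_blockSymbol_le ν ξ).trans ?_
  have hp : (0 : ℝ) < 2 ^ ν := by positivity
  have h3 := hχ.norm_lt_of_blockSymbol_ne_zero h0
  have h4 := hχ.lt_norm_of_blockSymbol_ne_zero hν h0
  have h5 : ∀ i, 3 / 5 * ((2 ^ ν)⁻¹ * |((2 * Real.pi) • ξ) i|)
      ≤ ‖character (EuclideanSpace.single i ((2 ^ ν)⁻¹ : ℝ)) ξ - 1‖ := by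
    intro i
    have h6 : 2 * Real.pi * inner ℝ (EuclideanSpace.single i ((2 ^ ν)⁻¹ : ℝ)) ξ
        = (2 ^ ν)⁻¹ * ((2 * Real.pi) • ξ) i := by
      simp [EuclideanSpace.inner_single_left]
      ring
    rw [character, h6]
    have h7 : |(2 ^ ν)⁻¹ * ((2 * Real.pi) • ξ) i| = (2 ^ ν)⁻¹ * |((2 * Real.pi) • ξ) i| := by
      rw [abs_mul, abs_of_pos (by positivity)]
    rw [← h7]
    refine le_norm_exp_I_mul_sub_one ?_
    rw [h7, inv_mul_le_iff₀ hp]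
    linarith [abs_apply_le_norm ((2 * Real.pi) • ξ) i]
  have h6 : 3 / 5 * ((2 ^ ν)⁻¹ * ‖(2 * Real.pi) • ξ‖)
      ≤ ∑ i, ‖character (EuclideanSpace.single i ((2 ^ ν)⁻¹ : ℝ)) ξ - 1‖ := by
    refine le_trans ?_ (Finset.sum_le_sum fun i _ => h5 i)
    rw [← Finset.mul_sum, ← Finset.mul_sum]
    gcongr
    exact norm_le_sum_abs _
  rw [← Finset.mul_sum]
  have h7 : 11 / 20 ≤ (2 ^ ν)⁻¹ * ‖(2 * Real.pi) • ξ‖ := by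
    rw [le_inv_mul_iff₀ hp]
    linarith
  linarith

end Bernstein

/-! ### Schur's test with geometric off-diagonal decay. -/

section Schur

/-- Schur's test for kernels on `ℕ × ℕ`. -/
theorem tsum_sq_tsum_mul_le (κ : ℕ → ℕ → ℝ≥0∞) (S : ℝ≥0∞) (h₁ : ∀ ν, ∑' k, κ ν k ≤ S)
    (h₂ : ∀ k, ∑' ν, κ ν k ≤ S) (c : ℕ → ℝ≥0∞) :
    ∑' ν, (∑' k, κ ν k * c k) ^ 2 ≤ 2 * S ^ 2 * ∑' k, c k ^ 2 := by
  -- Young's inequality without its factor `1/2`; this is the origin of the `2` in the conclusion.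
  have hmul : ∀ a b : ℝ≥0∞, a * b ≤ a ^ 2 + b ^ 2 := by
    intro a b
    rcases le_total a b with h | h
    · calc a * b ≤ b * b := by gcongr
        _ ≤ _ := by rw [sq b]; exact le_add_self
    · calc a * b ≤ a * a := by gcongr
        _ ≤ _ := by rw [sq a]; exact le_self_add
  have hrow : ∀ ν, (∑' k, κ ν k * c k) ^ 2 ≤ 2 * S * ∑' k, κ ν k * c k ^ 2 := by
    intro ν
    calc (∑' k, κ ν k * c k) ^ 2 = ∑' k, ∑' l, (κ ν k * c k) * (κ ν l * c l) := by
          rw [sq, ← ENNReal.tsum_mul_right]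
          simp_rw [← ENNReal.tsum_mul_left]
      _ ≤ ∑' k, ∑' l, (κ ν k * c k ^ 2 * κ ν l + κ ν k * (κ ν l * c l ^ 2)) := by
          refine ENNReal.tsum_le_tsum fun k => ENNReal.tsum_le_tsum fun l => ?_
          calc (κ ν k * c k) * (κ ν l * c l) = κ ν k * κ ν l * (c k * c l) := by ring
            _ ≤ κ ν k * κ ν l * (c k ^ 2 + c l ^ 2) := by gcongr; exact hmul _ _
            _ = _ := by ring
      _ = 2 * (∑' l, κ ν l) * ∑' k, κ ν k * c k ^ 2 := by
          simp_rw [ENNReal.tsum_add, ENNReal.tsum_mul_left, ENNReal.tsum_mul_right]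
          ring
      _ ≤ _ := by gcongr; exact h₁ ν
  calc ∑' ν, (∑' k, κ ν k * c k) ^ 2 ≤ ∑' ν, 2 * S * ∑' k, κ ν k * c k ^ 2 :=
        ENNReal.tsum_le_tsum hrow
    _ = 2 * S * ∑' k, (∑' ν, κ ν k) * c k ^ 2 := by
        rw [ENNReal.tsum_mul_left, ENNReal.tsum_comm]
        simp_rw [ENNReal.tsum_mul_right]
    _ ≤ 2 * S * ∑' k, S * c k ^ 2 := by
        gcongr with k
        exact h₂ k
    _ = _ := by rw [ENNReal.tsum_mul_left]; ring

/-- Each `k` is `ν + d` or `ν - d` with `d` the distance. Truncated subtraction only adds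
nonnegative terms at `k = 0`. -/
theorem tsum_pow_dist_le (q : ℝ≥0∞) (ν : ℕ) : ∑' k, q ^ Nat.dist ν k ≤ 2 * (1 - q)⁻¹ := by
  calc ∑' k, q ^ Nat.dist ν k
      ≤ ∑' k, ∑' d, ((if k = ν + d then q ^ d else 0) + if k = ν - d then q ^ d else 0) := by
        refine ENNReal.tsum_le_tsum fun k => ?_
        refine le_trans ?_ (ENNReal.le_tsum (Nat.dist ν k))
        rcases le_total ν k with h | h
        · rw [if_pos (by rw [Nat.dist_eq_sub_of_le h]; omega)]
          exact le_self_add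
        · rw [if_pos (c := k = ν - Nat.dist ν k) (by rw [Nat.dist_eq_sub_of_le_right h]; omega)]
          exact le_add_self
    _ = 2 * ∑' d, q ^ d := by
        rw [ENNReal.tsum_comm]
        simp_rw [ENNReal.tsum_add, tsum_ite_eq]
        ring
    _ = _ := by rw [ENNReal.tsum_geometric]

/-- The hypothesis is stated in `ℝ≥0∞` so that no convergence of the inner sums has to be known
beforehand; summability of the squares is part of the conclusion. -/
theorem tsum_sq_le_of_le_tsum_dist {q D : ℝ} (hq0 : 0 ≤ q) (hq1 : q < 1) (hD : 0 ≤ D)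
    {c X : ℕ → ℝ} (hc : ∀ k, 0 ≤ c k) (hX : ∀ ν, 0 ≤ X ν) (hs : Summable fun k => c k ^ 2)
    (h : ∀ ν, ENNReal.ofReal (X ν) ≤ ∑' k, ENNReal.ofReal (D * q ^ Nat.dist ν k * c k)) :
    (Summable fun ν => X ν ^ 2) ∧
      ∑' ν, X ν ^ 2 ≤ 2 * (2 * (1 - q)⁻¹) ^ 2 * D ^ 2 * ∑' k, c k ^ 2 := by
  have hq' : 0 < 1 - q := by linarith
  have hB : 0 ≤ 2 * (2 * (1 - q)⁻¹) ^ 2 * D ^ 2 * ∑' k, c k ^ 2 := by positivity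
  have key : ∑' ν, ENNReal.ofReal (X ν ^ 2)
      ≤ ENNReal.ofReal (2 * (2 * (1 - q)⁻¹) ^ 2 * D ^ 2 * ∑' k, c k ^ 2) := by
    have hschur := tsum_sq_tsum_mul_le (fun ν k => ENNReal.ofReal q ^ Nat.dist ν k)
      (2 * (1 - ENNReal.ofReal q)⁻¹) (tsum_pow_dist_le _)
      (fun k => by simpa only [Nat.dist_comm] using tsum_pow_dist_le (ENNReal.ofReal q) k)
      (fun k => ENNReal.ofReal (D * c k))
    have e1 : (1 - ENNReal.ofReal q)⁻¹ = ENNReal.ofReal ((1 - q)⁻¹) := by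
      rw [ENNReal.ofReal_inv_of_pos hq', ENNReal.ofReal_sub _ hq0, ENNReal.ofReal_one]
    have e2 : ∑' k, ENNReal.ofReal (D * c k) ^ 2 = ENNReal.ofReal (D ^ 2 * ∑' k, c k ^ 2) := by
      rw [← tsum_mul_left, ENNReal.ofReal_tsum_of_nonneg (fun k => by positivity) (hs.mul_left _)]
      congr 1 with k
      rw [← ENNReal.ofReal_pow (mul_nonneg hD (hc k)), mul_pow]
    rw [e1, e2] at hschur
    calc ∑' ν, ENNReal.ofReal (X ν ^ 2)
        ≤ ∑' ν, (∑' k, ENNReal.ofReal q ^ Nat.dist ν k * ENNReal.ofReal (D * c k)) ^ 2 := by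
          refine ENNReal.tsum_le_tsum fun ν => ?_
          rw [ENNReal.ofReal_pow (hX ν)]
          gcongr
          refine (h ν).trans_eq (tsum_congr fun k => ?_)
          rw [← ENNReal.ofReal_pow hq0, ← ENNReal.ofReal_mul (by positivity)]
          congr 1
          ring
      _ ≤ _ := hschur
      _ = _ := by
          rw [show (2 : ℝ≥0∞) = ENNReal.ofReal 2 by simp, ← ENNReal.ofReal_mul (by norm_num),
            ← ENNReal.ofReal_pow (by positivity), ← ENNReal.ofReal_mul (by norm_num),
            ← ENNReal.ofReal_mul (by positivity)]
          congr 1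
          ring
  have hne : ∑' ν, ENNReal.ofReal (X ν ^ 2) ≠ ⊤ := ne_top_of_le_ne_top ENNReal.ofReal_ne_top key
  have hsX : Summable fun ν => X ν ^ 2 := by
    have := ENNReal.summable_toReal hne
    simpa [ENNReal.toReal_ofReal, sq_nonneg] using this
  refine ⟨hsX, ?_⟩
  rw [← ENNReal.ofReal_tsum_of_nonneg (fun ν => sq_nonneg _) hsX] at key
  exact (ENNReal.ofReal_le_ofReal_iff hB).1 key

end Schur

/-! ### The expansion of `a - T_a^m` over the blocks. -/

section Remainder

variable {n : ℕ} {χ : ℝ → ℝ}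

/-- For `ν ≤ k` the sup bound gives the constant `8`. For `ν > k` each of the `n` directions
contributes `4 * (8 * 2 + 1) = 68`: the difference of `Δ_k u` costs `2 * 2^{k-ν}`, compensated by
the size `2^{-k}` of `b`, and the difference of `b` costs `2^{-ν}`. -/
theorem IsCutoff.norm_block_mulL2_block_le (hχ : IsCutoff χ) {b : Space n → ℂ} {L : ℝ≥0} {k : ℕ}
    (hb : ∀ x, ‖b x‖ ≤ 8 * L * (2 ^ k)⁻¹) (hL : LipschitzWith L b) (ν : ℕ) (u : L2 n) :
    ‖block χ ν (mulL2 b (block χ k u))‖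
      ≤ (68 * n + 8) * L * (2 ^ max ν k)⁻¹ * ‖block χ k u‖ := by
  have hm : Measurable b := hL.continuous.measurable
  rcases le_or_gt ν k with h | h
  · rw [max_eq_right h]
    refine (hχ.norm_block_le _ _).trans ((norm_mulL2_le hm hb _).trans ?_)
    gcongr
    have : (0 : ℝ) ≤ 68 * n := by positivity
    linarith
  · rw [max_eq_left h.le]
    refine (hχ.norm_block_le_sum_translate (by omega) _).trans ?_
    have hi : ∀ i : Fin n, 4 * ‖translate (EuclideanSpace.single i ((2 ^ ν)⁻¹ : ℝ))
        (mulL2 b (block χ k u)) - mulL2 b (block χ k u)‖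
          ≤ 68 * L * (2 ^ ν)⁻¹ * ‖block χ k u‖ := by
      intro i
      have h1 := norm_translate_mulL2_sub_le hm hb hL (EuclideanSpace.single i ((2 ^ ν)⁻¹ : ℝ))
        (block χ k u)
      have h2 := hχ.norm_translate_block_sub_le (EuclideanSpace.single i ((2 ^ ν)⁻¹ : ℝ)) k u
      have h3 : ‖(EuclideanSpace.single i ((2 ^ ν)⁻¹ : ℝ) : Space n)‖ = (2 ^ ν)⁻¹ := by
        simp
      rw [h3] at h1 h2
      calc _ ≤ 4 * (8 * L * (2 ^ k)⁻¹ * (2 * 2 ^ k * (2 ^ ν)⁻¹ * ‖block χ k u‖)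
            + L * (2 ^ ν)⁻¹ * ‖block χ k u‖) := by
            gcongr
            exact h1.trans (by gcongr)
        _ = _ := by field_simp; ring
    refine (Finset.sum_le_sum fun i _ => hi i).trans ?_
    rw [Finset.sum_const, Finset.card_univ, Fintype.card_fin, nsmul_eq_mul]
    have : 0 ≤ L * (2 ^ ν)⁻¹ * ‖block χ k u‖ := by positivity
    linarith

/-- The coefficients `b_k` of the expansion `(a - T_a^m) u = ∑_k b_k Δ_k u`. -/
noncomputable def remCoeff (χ : ℝ → ℝ) (m : ℕ) (a : Space n → ℂ) (k : ℕ) (x : Space n) : ℂ :=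
  a x - lowFreqFun χ (if k < m + 3 then (m : ℤ) - 1 else (k : ℤ) - 3) a x

theorem exists_remCoeff_bounds (hχ : IsCutoff χ) (n : ℕ) :
    ∃ M : ℝ≥0, ∀ (a : Space n → ℂ) (A : ℝ≥0), (∀ x, ‖a x‖ ≤ A) → LipschitzWith A a →
      (∀ k : ℤ, Measurable (lowFreqFun χ k a) ∧ ∀ x, ‖lowFreqFun χ k a x‖ ≤ (M * A : ℝ≥0)) ∧
      ∀ m k : ℕ, LipschitzWith (M * A) (remCoeff χ m a k) ∧
        ∀ x, ‖remCoeff χ m a k x‖ ≤ 8 * (M * A : ℝ≥0) * (2 ^ k)⁻¹ := by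
  obtain ⟨M, hM⟩ := hχ.exists_lowFreqFun_bounds n
  refine ⟨M, fun a A hA ha => ⟨fun k => ⟨?_, ?_⟩, fun m k => ?_⟩⟩
  · exact (hM a A hA ha k).2.1.continuous.measurable
  · simpa using (hM a A hA ha k).1
  · obtain ⟨-, -, h1, h2⟩ := hM a A hA ha (if k < m + 3 then (m : ℤ) - 1 else (k : ℤ) - 3)
    refine ⟨h1, fun x => (h2 x).trans ?_⟩
    -- In either case the cutoff index is at least `k - 3`; for `k ≤ m + 2` this is `m - 1 ≥ k - 3`.
    have h3 : (2 : ℝ) ^ (-(if k < m + 3 then (m : ℤ) - 1 else (k : ℤ) - 3)) ≤ 8 * (2 ^ k)⁻¹ := by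
      have : (8 : ℝ) * (2 ^ k)⁻¹ = 2 ^ (3 - (k : ℤ)) := by
        rw [zpow_sub₀ (by norm_num), zpow_natCast, div_eq_mul_inv]
        norm_num
      rw [this]
      refine zpow_le_zpow_right₀ (by norm_num) ?_
      split_ifs <;> omega
    rw [NNReal.coe_mul]
    calc _ ≤ (M * A : ℝ) * (8 * (2 ^ k)⁻¹) := by gcongr
      _ = _ := by ring

section Expansion

variable {a : Space n → ℂ} {B L : ℝ≥0} {m : ℕ}

theorem IsCutoff.summable_remCoeff (hχ : IsCutoff χ)
    (hrem : ∀ k : ℕ, LipschitzWith L (remCoeff χ m a k) ∧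
      ∀ x, ‖remCoeff χ m a k x‖ ≤ 8 * L * (2 ^ k)⁻¹) (u : L2 n) :
    Summable fun k => mulL2 (remCoeff χ m a k) (block χ k u) := by
  refine Summable.of_norm_bounded (g := fun k => 8 * L * ‖u‖ * (1 / 2) ^ k)
    ((summable_geometric_of_lt_one (by norm_num) (by norm_num)).mul_left _) fun k => ?_
  refine (norm_mulL2_le (hrem k).1.continuous.measurable (hrem k).2 _).trans ?_
  calc _ ≤ 8 * L * (2 ^ k)⁻¹ * ‖u‖ := by
        gcongr
        exact hχ.norm_block_le k u
    _ = _ := by rw [one_div, inv_pow]; ring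

theorem mulL2_remCoeff (ha : Measurable a) (hB : ∀ x, ‖a x‖ ≤ B)
    (hlow : ∀ k : ℤ, Measurable (lowFreqFun χ k a) ∧ ∀ x, ‖lowFreqFun χ k a x‖ ≤ L)
    (k : ℕ) (f : L2 n) :
    mulL2 (remCoeff χ m a k) f = mulL2 a f
      - mulL2 (lowFreqFun χ (if k < m + 3 then (m : ℤ) - 1 else (k : ℤ) - 3) a) f :=
  mulL2_sub_left ha hB (hlow _).1 (hlow _).2 f

theorem paraTerm_eq (ha : Measurable a) (hB : ∀ x, ‖a x‖ ≤ B)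
    (hlow : ∀ k : ℤ, Measurable (lowFreqFun χ k a) ∧ ∀ x, ‖lowFreqFun χ k a x‖ ≤ L)
    (u : L2 n) (l : ℕ) :
    paraTerm χ m a u l = mulL2 a (block χ (l + (m + 3)) u)
      - mulL2 (remCoeff χ m a (l + (m + 3))) (block χ (l + (m + 3)) u) := by
  rw [mulL2_remCoeff ha hB hlow, if_neg (by omega), paraTerm, sub_sub_cancel, add_comm (m + 3) l]
  congr 2
  push_cast
  ring

theorem IsCutoff.hasSum_mulL2_block (hχ : IsCutoff χ) (ha : Measurable a) (hB : ∀ x, ‖a x‖ ≤ B)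
    (u : L2 n) : HasSum (fun k => mulL2 a (block χ k u)) (mulL2 a u) :=
  (hχ.hasSum_block u).mapL (mulL2CLM a ha B hB)

theorem IsCutoff.summable_paraTerm (hχ : IsCutoff χ) (ha : Measurable a) (hB : ∀ x, ‖a x‖ ≤ B)
    (hlow : ∀ k : ℤ, Measurable (lowFreqFun χ k a) ∧ ∀ x, ‖lowFreqFun χ k a x‖ ≤ L)
    (hrem : ∀ k : ℕ, LipschitzWith L (remCoeff χ m a k) ∧
      ∀ x, ‖remCoeff χ m a k x‖ ≤ 8 * L * (2 ^ k)⁻¹) (u : L2 n) :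
    Summable (paraTerm χ m a u) := by
  have h1 := (summable_nat_add_iff (m + 3)).2 (hχ.hasSum_mulL2_block ha hB u).summable
  have h2 := (summable_nat_add_iff (m + 3)).2 (hχ.summable_remCoeff hrem u)
  refine (h1.sub h2).congr fun l => ?_
  rw [paraTerm_eq ha hB hlow]

/-- Split at `k = m + 3`: the blocks below add up to `S_{m+2}u`, all with the same coefficient, and
those above reproduce the terms of the paraproduct. -/
theorem IsCutoff.hasSum_remainder (hχ : IsCutoff χ) (ha : Measurable a) (hB : ∀ x, ‖a x‖ ≤ B)
    (hlow : ∀ k : ℤ, Measurable (lowFreqFun χ k a) ∧ ∀ x, ‖lowFreqFun χ k a x‖ ≤ L)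
    (hrem : ∀ k : ℕ, LipschitzWith L (remCoeff χ m a k) ∧
      ∀ x, ‖remCoeff χ m a k x‖ ≤ 8 * L * (2 ^ k)⁻¹) (u : L2 n) :
    HasSum (fun k => mulL2 (remCoeff χ m a k) (block χ k u))
      (mulL2 a u - paraproduct χ m a u) := by
  have hs := hχ.summable_remCoeff hrem u
  have hsa := hχ.hasSum_mulL2_block ha hB u
  have hsp := hχ.summable_paraTerm ha hB hlow hrem u
  have hsum : ∑ k ∈ Finset.range (m + 3), block χ k u = lowFreq χ ((m : ℤ) + 2) u := by
    rw [sum_range_block (m + 2)]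
    norm_cast
  have h1 : ∑ k ∈ Finset.range (m + 3), mulL2 a (block χ k u)
      = mulL2 a (lowFreq χ ((m : ℤ) + 2) u) := by
    rw [← hsum, ← mulL2CLM_apply a ha B hB, map_sum]
    rfl
  have h2 : ∑ k ∈ Finset.range (m + 3), mulL2 (remCoeff χ m a k) (block χ k u)
      = mulL2 a (lowFreq χ ((m : ℤ) + 2) u)
        - mulL2 (lowFreqFun χ ((m : ℤ) - 1) a) (lowFreq χ ((m : ℤ) + 2) u) := by
    rw [← h1, ← hsum, ← mulL2CLM_apply (lowFreqFun χ ((m : ℤ) - 1) a) (hlow _).1 L (hlow _).2,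
      map_sum, ← Finset.sum_sub_distrib]
    refine Finset.sum_congr rfl fun k hk => ?_
    rw [mulL2_remCoeff ha hB hlow, if_pos (Finset.mem_range.1 hk), mulL2CLM_apply]
  have h3 : ∑' l, mulL2 (remCoeff χ m a (l + (m + 3))) (block χ (l + (m + 3)) u)
      = ∑' l, mulL2 a (block χ (l + (m + 3)) u) - ∑' l, paraTerm χ m a u l := by
    rw [← ((summable_nat_add_iff (m + 3)).2 hsa.summable).tsum_sub hsp]
    refine tsum_congr fun l => ?_
    rw [paraTerm_eq ha hB hlow, sub_sub_cancel]
  have h4 := hsa.summable.sum_add_tsum_nat_add (m + 3)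
  rw [h1, hsa.tsum_eq] at h4
  refine hs.hasSum_iff.2 ?_
  rw [← hs.sum_add_tsum_nat_add (m + 3), h2, h3, paraproduct, ← h4]
  abel

end Expansion

end Remainder

/-! ### The gain of one derivative. -/

section Estimate

variable {n : ℕ} {χ : ℝ → ℝ}

/-- Comparing exponents, the kernel decays like `2^{-τ(ν-k)}` for `ν ≥ k` and like `2^{-(1-τ)(k-ν)}`
for `ν ≤ k`. -/
theorem two_pow_mul_rpow_le {τ δ : ℝ} (h1 : δ ≤ τ) (h2 : δ ≤ 1 - τ) (ν k : ℕ) :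
    2 ^ ν * (2 : ℝ) ^ (-(τ * ν)) * (2 ^ max ν k)⁻¹
      ≤ ((2 : ℝ) ^ (-δ)) ^ Nat.dist ν k * 2 ^ (-(τ * k)) := by
  have e1 : (2 : ℝ) ^ ν * (2 : ℝ) ^ (-(τ * ν)) * (2 ^ max ν k)⁻¹
      = 2 ^ ((ν : ℝ) + -(τ * ν) + -((max ν k : ℕ) : ℝ)) := by
    rw [Real.rpow_add (by norm_num), Real.rpow_add (by norm_num), Real.rpow_natCast,
      Real.rpow_neg (by norm_num) ((max ν k : ℕ) : ℝ), Real.rpow_natCast]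
  have e2 : ((2 : ℝ) ^ (-δ)) ^ Nat.dist ν k * 2 ^ (-(τ * k))
      = 2 ^ (-δ * (Nat.dist ν k : ℕ) + -(τ * k)) := by
    rw [Real.rpow_add (by norm_num), Real.rpow_mul_natCast (by norm_num)]
  rw [e1, e2]
  refine Real.rpow_le_rpow_of_exponent_le (by norm_num) ?_
  rcases le_total ν k with h | h
  · have hc : (ν : ℝ) ≤ k := by exact_mod_cast h
    rw [Nat.dist_eq_sub_of_le h, max_eq_right h, Nat.cast_sub h]
    nlinarith
  · have hc : (k : ℝ) ≤ ν := by exact_mod_cast h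
    rw [Nat.dist_eq_sub_of_le_right h, max_eq_left h, Nat.cast_sub h]
    nlinarith

/-- The remainder `a - T_a^m` gains one derivative on the Sobolev spaces of order `-τ`, uniformly
for `τ` in compact subsets of `(0, 1)`. -/
theorem IsCutoff.exists_remainder_estimate (hχ : IsCutoff χ) (n : ℕ) {δ : ℝ} (hδ : 0 < δ) :
    ∃ C : ℝ, 0 < C ∧ ∀ (m : ℕ) (a : Space n → ℂ) (A : ℝ≥0), (∀ x, ‖a x‖ ≤ A) → LipschitzWith A a →
      ∀ u : L2 n, Summable (paraTerm χ m a u) ∧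
        ∀ τ : ℝ, δ ≤ τ → δ ≤ 1 - τ →
        Summable (fun k : ℕ => ((2 : ℝ) ^ (-(τ * k)) * ‖block χ k u‖) ^ 2) →
        Summable (fun ν : ℕ => (2 ^ ν * (2 : ℝ) ^ (-(τ * ν)) *
          ‖block χ ν (mulL2 a u - paraproduct χ m a u)‖) ^ 2) ∧
        ∑' ν : ℕ, (2 ^ ν * (2 : ℝ) ^ (-(τ * ν)) *
          ‖block χ ν (mulL2 a u - paraproduct χ m a u)‖) ^ 2
            ≤ C * (A : ℝ) ^ 2 * ∑' k : ℕ, ((2 : ℝ) ^ (-(τ * k)) * ‖block χ k u‖) ^ 2 := by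
  obtain ⟨M, hM⟩ := exists_remCoeff_bounds hχ n
  set q : ℝ := 2 ^ (-δ)
  have hq0 : 0 ≤ q := by positivity
  have hq1 : q < 1 := Real.rpow_lt_one_of_one_lt_of_neg (by norm_num) (by linarith)
  have hq' : 0 < 1 - q := by linarith
  -- The constant of Schur's test; the added `1` only secures positivity.
  refine ⟨2 * (2 * (1 - q)⁻¹) ^ 2 * ((68 * n + 8) * M) ^ 2 + 1, by positivity,
    fun m a A hA hLip u => ?_⟩
  obtain ⟨hlow, hrem⟩ := hM a A hA hLip
  have ha : Measurable a := hLip.continuous.measurable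
  refine ⟨hχ.summable_paraTerm ha hA hlow (hrem m) u, fun τ h1 h2 hs => ?_⟩
  have hsum := hχ.hasSum_remainder ha hA hlow (hrem m) u
  have key := tsum_sq_le_of_le_tsum_dist hq0 hq1
    (D := (68 * n + 8) * (M * A : ℝ≥0)) (by positivity)
    (c := fun k : ℕ => (2 : ℝ) ^ (-(τ * k)) * ‖block χ k u‖)
    (X := fun ν : ℕ => 2 ^ ν * (2 : ℝ) ^ (-(τ * ν)) *
      ‖block χ ν (mulL2 a u - paraproduct χ m a u)‖)
    (fun k => by positivity) (fun ν => by positivity) hs ?_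
  · refine ⟨key.1, key.2.trans ?_⟩
    have h3 : 0 ≤ ∑' k : ℕ, ((2 : ℝ) ^ (-(τ * k)) * ‖block χ k u‖) ^ 2 := by positivity
    rw [NNReal.coe_mul]
    have h4 : 0 ≤ (A : ℝ) ^ 2 * ∑' k : ℕ, ((2 : ℝ) ^ (-(τ * k)) * ‖block χ k u‖) ^ 2 := by
      positivity
    linarith
  · intro ν
    have hb : block χ ν (mulL2 a u - paraproduct χ m a u)
        = ∑' k, block χ ν (mulL2 (remCoeff χ m a k) (block χ k u)) := by
      simp_rw [← hχ.blockCLM_apply ν]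
      exact (hsum.mapL (hχ.blockCLM ν)).tsum_eq.symm
    have hw : 0 ≤ 2 ^ ν * (2 : ℝ) ^ (-(τ * ν)) := by positivity
    rw [ENNReal.ofReal_mul hw, ofReal_norm, hb]
    refine (mul_le_mul_right enorm_tsum_le_tsum_enorm _).trans ?_
    rw [← ENNReal.tsum_mul_left]
    refine ENNReal.tsum_le_tsum fun k => ?_
    rw [← ofReal_norm, ← ENNReal.ofReal_mul hw]
    refine ENNReal.ofReal_le_ofReal ?_
    have h4 := hχ.norm_block_mulL2_block_le (hrem m k).2 (hrem m k).1 ν u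
    have h5 := two_pow_mul_rpow_le h1 h2 ν k
    set L : ℝ := ((M * A : ℝ≥0) : ℝ)
    have hL : 0 ≤ L := NNReal.coe_nonneg _
    calc _ ≤ 2 ^ ν * (2 : ℝ) ^ (-(τ * ν)) *
          ((68 * n + 8) * L * (2 ^ max ν k)⁻¹ * ‖block χ k u‖) := by gcongr
      _ = (68 * n + 8) * L * (2 ^ ν * (2 : ℝ) ^ (-(τ * ν)) * (2 ^ max ν k)⁻¹) *
          ‖block χ k u‖ := by ring
      _ ≤ (68 * n + 8) * L * (q ^ Nat.dist ν k * 2 ^ (-(τ * k))) * ‖block χ k u‖ := by gcongr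
      _ = _ := by ring

end Estimate

/-! ### The weighted pieces `v_ν` and their time derivatives. -/

section Pieces

variable {n : ℕ} {χ : ℝ → ℝ} {s α T t : ℝ} {w : ℝ → L2 n}

theorem weight_pos (s α t : ℝ) (ν : ℕ) : 0 < weight s α t ν := by
  unfold weight
  positivity

theorem weight_le (hα : 0 < α) (ht : 0 ≤ t) (ν : ℕ) : weight s α t ν ≤ ((2 : ℝ) ^ (-s)) ^ ν := by
  rw [weight, ← Real.rpow_mul_natCast (by norm_num)]
  refine Real.rpow_le_rpow_of_exponent_le (by norm_num) ?_
  have : 0 ≤ α * t * ν := by positivity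
  linarith

theorem hasDerivAt_weight (s α t : ℝ) (ν : ℕ) :
    HasDerivAt (fun t => weight s α t ν) (-(α * ν * Real.log 2) * weight s α t ν) t := by
  have h1 : HasDerivAt (fun t : ℝ => -((s + α * t) * ν)) (-(α * ν)) t := by
    simpa using ((((hasDerivAt_id t).const_mul α).const_add s).mul_const (ν : ℝ)).fun_neg
  change HasDerivAt (fun t => (2 : ℝ) ^ (-((s + α * t) * ν))) (-(α * ν * Real.log 2) *
    (2 : ℝ) ^ (-((s + α * t) * ν))) t
  exact (h1.const_rpow (a := 2) (by norm_num)).congr_deriv (by ring)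

/-- The derivative is written as `Δ_ν` of an `L²` function so that Bernstein's inequality applies to
it. The vector `w'` is common to all `ν`, which makes the derivatives square summable. -/
theorem IsCutoff.exists_hasDerivWithinAt_vPiece (hχ : IsCutoff χ) (hw : MemH T w)
    (ht : t ∈ Set.Ico 0 T) :
    ∃ w' : L2 n, ∀ (s α : ℝ) (ν : ℕ), HasDerivWithinAt (vPiece χ s α w ν)
      (block χ ν (weight s α t ν • (w' - (α * ν * Real.log 2) • w t))) (Set.Ico 0 T) t := by
  have hd : DifferentiableWithinAt ℝ w (Set.Ico 0 T) t :=
    (hw.contDiffOn.differentiableOn (by norm_num)) t ht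
  refine ⟨derivWithin w (Set.Ico 0 T) t, fun s α ν => ?_⟩
  have h1 := (((hχ.blockCLM ν).restrictScalars ℝ).hasFDerivAt (x := w t)).comp_hasDerivWithinAt t
    hd.hasDerivWithinAt
  have h2 := (hasDerivAt_weight s α t ν).hasDerivWithinAt (s := Set.Ico 0 T) |>.smul h1
  have h3 : vPiece χ s α w ν = fun t => weight s α t ν •
      ((hχ.blockCLM ν).restrictScalars ℝ ∘ w) t := by
    ext1 t
    simp [vPiece, hχ.blockCLM_apply]
  rw [h3]
  refine h2.congr_deriv ?_
  rw [← hχ.blockCLM_apply]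
  change _ = (hχ.blockCLM ν).restrictScalars ℝ _
  simp only [map_smul, map_sub, Function.comp_apply]
  module

/-- The linear factor accommodates the `ν` produced by differentiating the weight in time. -/
theorem summable_sq_mul_geometric {q : ℝ} (hq0 : 0 ≤ q) (hq1 : q < 1) (b c : ℝ) :
    Summable fun ν : ℕ => (q ^ ν * (b + c * ν)) ^ 2 := by
  have hq2 : ‖q ^ 2‖ < 1 := by
    rw [Real.norm_of_nonneg (by positivity)]
    exact pow_lt_one₀ hq0 hq1 (by norm_num)
  have h0 := (summable_pow_mul_geometric_of_norm_lt_one 0 hq2).mul_left (b ^ 2)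
  have h1 := (summable_pow_mul_geometric_of_norm_lt_one 1 hq2).mul_left (2 * b * c)
  have h2 := (summable_pow_mul_geometric_of_norm_lt_one 2 hq2).mul_left (c ^ 2)
  refine ((h0.add h1).add h2).congr fun ν => ?_
  rw [← pow_mul, mul_comm 2 ν, pow_mul]
  ring

theorem two_rpow_neg_lt_one (hs : 0 < s) : (2 : ℝ) ^ (-s) < 1 :=
  Real.rpow_lt_one_of_one_lt_of_neg (by norm_num) (by linarith)

theorem norm_vPiece (ν : ℕ) :
    ‖vPiece χ s α w ν t‖ = weight s α t ν * ‖block χ ν (w t)‖ := by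
  rw [vPiece, norm_smul, Real.norm_of_nonneg (weight_pos _ _ _ _).le]

theorem IsCutoff.summable_vPiece (hχ : IsCutoff χ) (hs : 0 < s) (hα : 0 < α) (hw : MemH T w)
    (ht : t ∈ Set.Ico 0 T) :
    Summable (fun ν : ℕ => (2 : ℝ) ^ (2 * ν) * ‖vPiece χ s α w ν t‖ ^ 2) := by
  set W := ‖w t‖ + ∑ j, 2 * ‖partialL2 j (w t)‖
  have hW : 0 ≤ W := by positivity
  refine Summable.of_nonneg_of_le (fun ν => by positivity) (fun ν => ?_)
    (summable_sq_mul_geometric (by positivity) (two_rpow_neg_lt_one hs) W 0)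
  have h1 := hχ.two_pow_mul_norm_block_le (hw.hasPartial t ht) ν
  rw [norm_vPiece]
  calc (2 : ℝ) ^ (2 * ν) * (weight s α t ν * ‖block χ ν (w t)‖) ^ 2
      = (weight s α t ν * (2 ^ ν * ‖block χ ν (w t)‖)) ^ 2 := by rw [mul_comm 2 ν, pow_mul]; ring
    _ ≤ (((2 : ℝ) ^ (-s)) ^ ν * W) ^ 2 := by
        have := (weight_pos s α t ν).le
        gcongr
        exact weight_le hα ht.1 ν
    _ = _ := by rw [zero_mul, add_zero]

end Pieces

end LittlewoodPaley

open LittlewoodPaley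
theorem mainTheorem4 (n : ℕ) (χ : ℝ → ℝ) (hχ : IsCutoff χ) (s : ℝ) (hs : s ∈ Set.Ioo (0 : ℝ) 1) :
    ∃ C : ℝ, 0 < C ∧
      ∀ (m : ℕ) (a : Space n → ℂ) (A : ℝ≥0),
        (∀ x, ‖a x‖ ≤ A) → LipschitzWith A a →
      ∀ (α T t : ℝ), 0 < α → t ∈ Set.Icc 0 (7 / 8 * ((1 - s) / α)) → t < T →
      ∀ (w : ℝ → L2 n), MemH T w → ∀ i j : Fin n,
        -- the objects in the estimate are well defined
        Summable (paraTerm χ m a (partialL2 j (w t))) ∧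
        (∀ ν, DifferentiableWithinAt ℝ (vPiece χ s α w ν) (Set.Ico 0 T) t) ∧
        (∀ ν, HasPartial i (dtPiece χ s α T w ν t) (partialL2 i (dtPiece χ s α T w ν t))) ∧
        Summable (pairing χ m a s α T w i j t) ∧
        Summable (fun ν : ℕ => ‖dtPiece χ s α T w ν t‖ ^ 2) ∧
        Summable (fun ν : ℕ => (2 : ℝ) ^ (2 * ν) * ‖vPiece χ s α w ν t‖ ^ 2) ∧
        -- the estimate
        ∀ N : ℝ, 0 < N →
          ‖∑' ν : ℕ, pairing χ m a s α T w i j t ν‖ ≤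
            1 / N * ∑' ν : ℕ, ‖dtPiece χ s α T w ν t‖ ^ 2
              + C * (A : ℝ) ^ 2 * N *
                  ∑' ν : ℕ, (2 : ℝ) ^ (2 * ν) * ‖vPiece χ s α w ν t‖ ^ 2 := by
  obtain ⟨hs0, hs1⟩ := hs
  obtain ⟨C, hC, hmain⟩ := hχ.exists_remainder_estimate n
    -- From `0 ≤ αt ≤ 7/8 (1 - s)`, the order `τ = s + αt` satisfies `τ ≥ s` and `1 - τ ≥ (1 -
    -- s)/8`.
    (δ := min s ((1 - s) / 8)) (lt_min hs0 (by linarith))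
  -- The factor `4` is the square of the Bernstein constant for `∂_j`.
  refine ⟨C * 4, by positivity, fun m a A hA hLip α T t hα ht htT w hw i j => ?_⟩
  have htI : t ∈ Set.Ico 0 T := ⟨ht.1, htT⟩
  obtain ⟨hpara, hest⟩ := hmain m a A hA hLip (partialL2 j (w t))
  obtain ⟨w', hderiv⟩ := hχ.exists_hasDerivWithinAt_vPiece hw htI
  have hdt : ∀ ν, dtPiece χ s α T w ν t
      = block χ ν (weight s α t ν • (w' - (α * ν * Real.log 2) • w t)) := fun ν =>
    (hderiv s α ν).derivWithin (uniqueDiffOn_Ico 0 T t htI)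
  have hpart : ∀ ν, HasPartial i (dtPiece χ s α T w ν t) (partialL2 i (dtPiece χ s α T w ν t)) ∧
      ‖partialL2 i (dtPiece χ s α T w ν t)‖ ≤ 2 * 2 ^ ν * ‖dtPiece χ s α T w ν t‖ := by
    intro ν
    obtain ⟨g, hg, hg'⟩ := hχ.exists_hasPartial_block i ν
      (weight s α t ν • (w' - (α * ν * Real.log 2) • w t))
    rw [← hdt ν] at hg hg'
    rw [hg.partialL2_eq]
    exact ⟨hg, hg'⟩
  have hsd : Summable (fun ν : ℕ => ‖dtPiece χ s α T w ν t‖ ^ 2) := by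
    refine Summable.of_nonneg_of_le (fun ν => by positivity) (fun ν => ?_)
      (summable_sq_mul_geometric (by positivity) (two_rpow_neg_lt_one hs0) ‖w'‖
        (α * Real.log 2 * ‖w t‖))
    have hlog : 0 < Real.log 2 := Real.log_pos (by norm_num)
    have hwt := (weight_pos s α t ν).le
    rw [hdt]
    refine pow_le_pow_left₀ (norm_nonneg _) ((hχ.norm_block_le _ _).trans ?_) 2
    rw [norm_smul, Real.norm_of_nonneg hwt]
    have h1 : ‖w' - (α * ν * Real.log 2) • w t‖ ≤ ‖w'‖ + α * Real.log 2 * ‖w t‖ * ν := by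
      refine (norm_sub_le _ _).trans (le_of_eq ?_)
      rw [norm_smul, Real.norm_of_nonneg (by positivity)]
      ring
    gcongr
    exact weight_le hα ht.1 ν
  have hsv := hχ.summable_vPiece hs0 hα hw htI
  have hτ : α * t ≤ 7 / 8 * (1 - s) := by
    calc α * t ≤ α * (7 / 8 * ((1 - s) / α)) := by gcongr; exact ht.2
      _ = _ := by field_simp
  have hαt : 0 ≤ α * t := mul_nonneg hα.le ht.1
  have hcle : ∀ k : ℕ, ((2 : ℝ) ^ (-((s + α * t) * k)) * ‖block χ k (partialL2 j (w t))‖) ^ 2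
      ≤ 4 * ((2 : ℝ) ^ (2 * k) * ‖vPiece χ s α w k t‖ ^ 2) := by
    intro k
    have h1 := hχ.norm_block_partial_le (hw.hasPartial t htI j) k
    rw [norm_vPiece, weight]
    calc _ ≤ ((2 : ℝ) ^ (-((s + α * t) * k)) * (2 * 2 ^ k * ‖block χ k (w t)‖)) ^ 2 := by gcongr
      _ = _ := by rw [mul_comm 2 k, pow_mul]; ring
  have hsc : Summable fun k : ℕ =>
      ((2 : ℝ) ^ (-((s + α * t) * k)) * ‖block χ k (partialL2 j (w t))‖) ^ 2 :=
    Summable.of_nonneg_of_le (fun k => sq_nonneg _) hcle (hsv.mul_left 4)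
  obtain ⟨hsX, hX⟩ := hest (s + α * t) ((min_le_left _ _).trans (by linarith))
    ((min_le_right _ _).trans (by linarith)) hsc
  set X : ℕ → ℝ := fun ν => 2 ^ ν * (2 : ℝ) ^ (-((s + α * t) * ν)) *
    ‖block χ ν (mulL2 a (partialL2 j (w t)) - paraproduct χ m a (partialL2 j (w t)))‖
  -- The factor `2^ν` lost by `∂_i` goes to the remainder, where the gained derivative absorbs it.
  -- The Bernstein constant `2` is exactly the one in `2xy ≤ x²/N + N y²`.
  have hpair : ∀ N : ℝ, 0 < N → ∀ ν, ‖pairing χ m a s α T w i j t ν‖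
      ≤ 1 / N * ‖dtPiece χ s α T w ν t‖ ^ 2 + N * X ν ^ 2 := by
    intro N hN ν
    have hwt := weight_pos s α t ν
    have h1 : ‖pairing χ m a s α T w i j t ν‖ ≤ 2 * ‖dtPiece χ s α T w ν t‖ * X ν := by
      rw [pairing, norm_mul, Complex.norm_real, Real.norm_of_nonneg hwt.le]
      calc _ ≤ weight s α t ν * (‖block χ ν (mulL2 a (partialL2 j (w t))
            - paraproduct χ m a (partialL2 j (w t)))‖
              * (2 * 2 ^ ν * ‖dtPiece χ s α T w ν t‖)) := by
            gcongr
            exact (norm_inner_le_norm _ _).trans (by gcongr; exact (hpart ν).2)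
        _ = _ := by simp only [X, weight]; ring
    have h2 : 1 / N * ‖dtPiece χ s α T w ν t‖ ^ 2 + N * X ν ^ 2
        - 2 * ‖dtPiece χ s α T w ν t‖ * X ν = 1 / N * (‖dtPiece χ s α T w ν t‖ - N * X ν) ^ 2 := by
      field_simp
      ring
    have h3 : 0 ≤ 1 / N * (‖dtPiece χ s α T w ν t‖ - N * X ν) ^ 2 := by positivity
    linarith
  have hsb : ∀ N : ℝ, Summable fun ν => 1 / N * ‖dtPiece χ s α T w ν t‖ ^ 2 + N * X ν ^ 2 :=
    fun N => (hsd.mul_left _).add (hsX.mul_left _)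
  refine ⟨hpara, fun ν => (hderiv s α ν).differentiableWithinAt, fun ν => (hpart ν).1,
    Summable.of_norm_bounded (hsb 1) (hpair 1 one_pos), hsd, hsv, fun N hN => ?_⟩
  refine (tsum_of_norm_bounded (hsb N).hasSum (hpair N hN)).trans ?_
  rw [(hsd.mul_left (1 / N)).tsum_add (hsX.mul_left N), tsum_mul_left, tsum_mul_left]
  have h5 : ∑' k : ℕ, ((2 : ℝ) ^ (-((s + α * t) * k)) * ‖block χ k (partialL2 j (w t))‖) ^ 2
      ≤ 4 * ∑' k : ℕ, (2 : ℝ) ^ (2 * k) * ‖vPiece χ s α w k t‖ ^ 2 := by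
    rw [← tsum_mul_left]
    exact hsc.tsum_le_tsum hcle (hsv.mul_left 4)
  refine add_le_add le_rfl ?_
  calc N * ∑' ν, X ν ^ 2 ≤ N * (C * (A : ℝ) ^ 2 *
        (4 * ∑' k : ℕ, (2 : ℝ) ^ (2 * k) * ‖vPiece χ s α w k t‖ ^ 2)) := by
        gcongr
        exact hX.trans (by gcongr)
    _ = _ := by ring
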